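/- All graphs are finite, simple and undirected. Let $H$ be a graph with vertices $1,\dots,r$, let $X_i$ be a nonempty $k_i$-regular graph with $n_i$ vertices ($i=1,\dots,r$), and let $X=H[X_1,\dots,X_r]$ be the generalized join: $V(X)$ is the disjoint union of the $V(X_i)$, two vertices of $V(X_i)$ are adjacent in $X$ iff they are adjacent in $X_i$, and for $i\ne j$ a vertex of $V(X_i)$ is adjacent to a vertex of $V(X_j)$ iff $A(H)_{ij}=1$. Here $A(\cdot)$ is the adjacency matrix. Write $\phi(M,x)=\det(xI-M)$ and $\pi=\{V(X_1),\dots,V(X_r)\}$. Then $\pi$ is an equitable partition of $X$, that is, for all $i,j$ the number $b_{ij}$ of edges that go from $v\in V(X_i)$ to $V(X_j)$ does not depend on $v$; put $A(X/\pi)=(b_{ij})$. For all $\alpha,d_1,\dots,d_r\in\mathbb C$, let $D$ be the diagonal matrix indexed by $V(X)$ whose entries on $V(X_i)$ are equal to $d_i$. Then, as rational functions of $x$, $$\phi(\alpha A(X)+D,x)=\phi\big(\alpha A(X/\pi)+(\delta_{ij}d_i),x\big)\prod_{i=1}^r\frac{\phi(\alpha A(X_i)+d_iI,x)}{x-\alpha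 k_i-d_i} =\det\big(-\alpha A(H)+\mathbb D(x)\big)\prod_{i=1}^r\frac{n_i\,\phi(\alpha A(X_i)+d_iI,x)}{x-\alpha k_i-d_i},$$ where $\mathbb D(x)_{ij}=\delta_{ij}\frac1{n_i}(x-\alpha k_i-d_i)$. In particular: (a) $$\phi(A(X),x)=\phi(A(X/\pi),x)\prod_{i=1}^r\frac{\phi(A(X_i),x)}{x-k_i}=\det\Big(-A(H)+\big(\delta_{ij}\tfrac{x-k_i}{n_i}\big)\Big)\prod_{i=1}^r\frac{n_i\,\phi(A(X_i),x)}{x-k_i}.$$ (b) Let $n$ and $m$ be the numbers of vertices and (non-oriented) edges of $X$, and for $u,t\in\mathbb C$ let $$Z_X(u,t)=\prod_{[C]}\frac1{1-u^{\mathrm{cbc}(C)}t^{|C|}},$$ where $[C]$ runs over the prime cycles of $X$: the classes, under cyclic permutation, of closed paths $C=(e_1,\dots,e_l)$ of oriented edges, $l=|C|\ge1$ (the terminus of $e_i$ is the origin of $e_{i+1}$, indices modulo $l$), that are not of the form $B^q$ with $q\ge2$; and $\mathrm{cbc}(C)$ is the number of $i\in\mathbb Z/l\mathbb Z$ such that $e_{i+1}$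 is the inverse of $e_i$. Let $s_1=1-(1-u)^2t^2$, $s_2=(1-u)t^2$, $d_i^Z=s_1+s_2d_i(X)$, where $d_i(X)=k_i+\sum_{j\ne i}A(H)_{ij}n_j$; every vertex of $V(X_i)$ has degree $d_i(X)$ in $X$. For each $u\in\mathbb C$ and all $t$ in some neighbourhood of $0$, the product $Z_X(u,t)$ converges absolutely (that is, $\sum_{[C]}|u^{\mathrm{cbc}(C)}t^{|C|}|<\infty$), $s_1\neq0$, and $-tk_i+d_i^Z\ne0$ for all $i$. For all $u,t\in\mathbb C$ such that $Z_X(u,t)$ converges absolutely in this sense, $-tk_i+d_i^Z\neq0$ for all $i$, and moreover $s_1\ne0$ in the case $m<n$, $$Z_X(u,t)^{-1}=s_1^{m-n}\det\big(-tA(X/\pi)+(\delta_{ij}d_i^Z)\big)\prod_{i=1}^r\frac{\det(-tA(X_i)+d_i^ZI)}{-tk_i+d_i^Z} =s_1^{m-n}\det\big(-tA(H)+\mathbb D\big)\prod_{i=1}^r\frac{n_i\det(-tA(X_i)+d_i^ZI)}{-tk_i+d_i^Z},$$ where $\mathbb D_{ij}=\delta_{ij}\frac1{n_i}(-tk_i+d_i^Z)$.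 (If a factor $1-u^{\mathrm{cbc}(C)}t^{|C|}$ vanishes, $Z_X(u,t)^{-1}$ is read as $0$; and $0^0=1$.) -/

import Mathlib

open scoped Polynomial Topology

/-- The generalized join (composition) `H[X_i]`: its vertex set is the disjoint union of the vertex
sets of the graphs `X i`; inside the `i`-th part it is `X i`, and a vertex of part `i` is adjacent
to a vertex of a different part `j` exactly when `i` and `j` are adjacent in `H`. -/
def generalizedJoin {ι : Type*} {V : ι → Type*} (H : SimpleGraph ι)
    (X : ∀ i, SimpleGraph (V i)) : SimpleGraph (Σ i, V i) where
  Adj p q := H.Adj p.1 q.1 ∨ ∃ h : p.1 = q.1, (X q.1).Adj (h ▸ p.2) q.2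
  symm := ⟨by
    rintro ⟨i, a⟩ ⟨j, b⟩ (h | ⟨h, h'⟩)
    · exact Or.inl h.symm
    · obtain rfl : i = j := h
      exact Or.inr ⟨rfl, h'.symm⟩⟩
  loopless := ⟨by
    rintro ⟨i, a⟩ (h | ⟨_, h'⟩)
    · exact H.irrefl h
    · exact (X i).irrefl h'⟩

section Partition

variable {V ι : Type*} [Fintype V] [DecidableEq ι]

/-- The vertices are partitioned into the cells `c ⁻¹' {j}`. This is the number of edges that go
from the vertex `u` to the cell of `j`. -/
def cellDegree (G : SimpleGraph V) [DecidableRel G.Adj] (c : V → ι) (u : V) (j : ι) : ℕ :=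
  (Finset.univ.filter fun w => G.Adj u w ∧ c w = j).card

/-- The partition into the cells `c ⁻¹' {j}` is equitable: for all cells `i` and `j`, the number of
edges that go from `u` to the cell `j` is the same for all vertices `u` of the cell `i`. -/
def IsEquitablePartition (G : SimpleGraph V) [DecidableRel G.Adj] (c : V → ι) : Prop :=
  ∀ u v, c u = c v → ∀ j, cellDegree G c u j = cellDegree G c v j

/-- The adjacency matrix of the weighted quotient of `G` over the partition into the (nonempty)
cells `c ⁻¹' {j}`: its `(i, j)` entry is the number of edges that go from a vertex of the cell `i`
to the cell `j`. For an equitable partition the choice of that vertex does not matter. -/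
noncomputable def quotientAdjMatrix (R : Type*) [NatCast R] (G : SimpleGraph V)
    [DecidableRel G.Adj] (c : V → ι) (hc : Function.Surjective c) : Matrix ι ι R :=
  Matrix.of fun i j => (cellDegree G c (Function.surjInv hc i) j : R)

end Partition

section Zeta

variable {V : Type*}

open Classical in
/-- The number of indices `i` (cyclically) at which the edge sequence `(e_1, …, e_k)` backtracks,
that is, `e_{i+1}` is the inverse of `e_i`, where `e_{k+1} = e_1`. -/
noncomputable def listBumpCount {G : SimpleGraph V} (l : List G.Dart) : ℕ :=
  (List.zipWith (fun e f => if f = e.symm then 1 else 0) l (l.rotate 1)).sum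

/-- The cyclic bump count of a cyclic sequence of oriented edges. -/
noncomputable def cyclicBumpCount {G : SimpleGraph V} (C : Cycle G.Dart) : ℕ :=
  Quotient.liftOn' C listBumpCount (by
    rintro l _ ⟨n, rfl⟩
    unfold listBumpCount
    rw [List.rotate_rotate, Nat.add_comm n 1, ← List.rotate_rotate,
      ← List.zipWith_rotate_distrib _ _ _ _ (by simp)]
    exact ((List.rotate_perm _ n).sum_eq).symm)

/-- `C` is a prime cycle of `G`: the class, under cyclic permutation, of a nonempty closed path
`(e_1, …, e_k)` of oriented edges (each edge starts where the cyclically preceding one ends;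
backtracking is allowed), no representative of which is a proper power of an edge sequence. -/
def IsPrimeCycle (G : SimpleGraph V) (C : Cycle G.Dart) : Prop :=
  C ≠ Cycle.nil ∧ C.Chain (fun e f => e.snd = f.fst) ∧
    ∀ (l : List G.Dart) (k : ℕ), 2 ≤ k → C ≠ ((List.replicate k l).flatten : Cycle G.Dart)

/-- The set of prime cycles of `G`. -/
abbrev PrimeCycle (G : SimpleGraph V) : Type _ := {C : Cycle G.Dart // IsPrimeCycle G C}

/-- The term `u ^ cbc(C) * t ^ |C|` attached to a prime cycle. -/
noncomputable def bartholdiTerm (G : SimpleGraph V) (u t : ℂ) (C : PrimeCycle G) : ℂ :=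
  u ^ cyclicBumpCount C.1 * t ^ C.1.length

/-- The Euler product of the Bartholdi zeta function converges absolutely at `(u, t)`. -/
def BartholdiConverges (G : SimpleGraph V) (u t : ℂ) : Prop :=
  Summable fun C : PrimeCycle G => ‖bartholdiTerm G u t C‖

/-- The Ihara-Bartholdi zeta function `Z_G(u, t)`, as the Euler product over the prime cycles. -/
noncomputable def bartholdiZeta (G : SimpleGraph V) (u t : ℂ) : ℂ :=
  ∏' C : PrimeCycle G, 1 / (1 - bartholdiTerm G u t C)

/-- `s_1 = 1 - (1 - u)^2 t^2`. -/
def bartholdiS₁ (u t : ℂ) : ℂ := 1 - (1 - u) ^ 2 * t ^ 2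

/-- `s_2 = (1 - u) t^2`. -/
def bartholdiS₂ (u t : ℂ) : ℂ := (1 - u) * t ^ 2

end Zeta

section JoinDegree

variable {ι : Type*} [Fintype ι] [DecidableEq ι]

/-- `d_i(X) = k_i + ∑_{j ≠ i} A(H)_{ij} n_j`, the degree in the join of the vertices of part `i`. -/
def joinDegree (V : ι → Type*) [∀ i, Fintype (V i)] (H : SimpleGraph ι) [DecidableRel H.Adj]
    (k : ι → ℕ) (i : ι) : ℕ :=
  k i + ∑ j ∈ Finset.univ.erase i, H.adjMatrix ℕ i j * Fintype.card (V j)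

/-- `d_i^Z(X) = s_1 + s_2 d_i(X)`. -/
def joinZetaDegree (V : ι → Type*) [∀ i, Fintype (V i)] (H : SimpleGraph ι) [DecidableRel H.Adj]
    (k : ι → ℕ) (u t : ℂ) (i : ι) : ℂ :=
  bartholdiS₁ u t + bartholdiS₂ u t * (joinDegree V H k i : ℂ)

end JoinDegree

/-! Two independent facts carry the theorem: a determinant formula for joins and a determinant
formula for the zeta function.

Joins. Let `P` be the 0/1 matrix sending a vertex to its part, `P'` its transpose, and `B` a block
diagonal matrix whose `i`-th block has constant row sums `r i ≠ 0`. Then `B P = P diag(r)`, so `B +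
P C P' = B (1 + P diag(r)⁻¹ C P')`. The Weinstein–Aronszajn identity shrinks the second factor to a
determinant indexed by the parts, with `P' P = diag(n)`; the blocks themselves may be singular
(`det_joinMatrix_quotient`). Regularity of the `X i` gives the constant row sums. Over `ℂ(x)` this
yields the characteristic polynomials, where the denominators are automatically nonzero; over `ℂ` it
evaluates the vertex matrix of the zeta function.

Zeta function. Let `W` be the matrix on oriented edges with entry `t` for a step without
backtracking, `t u` for a backtracking one and `0` for edges that do not compose. Amitsur's identity
says that the product of `1 - weight` over primitive cyclic words is `det (1 - W)`. For small `W` it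
comes from summing `weight / length` over all words in two ways: by length, which gives traces of
powers and so the eigenvalues, and by primitive root, which gives the logarithms of the Euler
factors. Analytic continuation along `z W` extends it to every absolutely convergent product
(`tprod_one_sub_cycleWeight`). Bass' formula (`det_one_sub_bartholdiEdgeMatrix`) then replaces `det
(1 - W)` by a determinant on vertices. Since degrees in the join are constant on the parts, that
determinant has the form treated first. -/

/-! ### Periods of words under cyclic rotation. -/

namespace List

variable {α : Type*}

/-- Cyclic rotation of a word by one letter. -/
def rotateOne (l : List α) : List α := l.rotate 1

theorem rotateOne_iterate (n : ℕ) (l : List α) : rotateOne^[n] l = l.rotate n := by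
  induction n with
  | zero => simp
  | succ n ih => rw [Function.iterate_succ_apply', ih, rotateOne, rotate_rotate]

theorem isPeriodicPt_rotateOne_iff {n : ℕ} {l : List α} :
    Function.IsPeriodicPt rotateOne n l ↔ l.rotate n = l := by
  rw [Function.IsPeriodicPt, Function.IsFixedPt, rotateOne_iterate]

theorem isPeriodicPt_rotateOne_length (l : List α) :
    Function.IsPeriodicPt rotateOne l.length l :=
  isPeriodicPt_rotateOne_iff.2 l.rotate_length

theorem rotateOne_flatten_replicate (k : ℕ) (l : List α) :
    rotateOne (replicate k l).flatten = (replicate k (rotateOne l)).flatten := by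
  cases l with
  | nil => simp [rotateOne]
  | cons a s =>
    have key : ∀ k, (replicate k (a :: s)).flatten ++ [a]
        = a :: (replicate k (s ++ [a])).flatten := by
      intro k
      induction k with
      | zero => simp
      | succ k ih => simp [replicate_succ, ih]
    cases k with
    | zero => simp [rotateOne]
    | succ k => simp [rotateOne, replicate_succ, key]

theorem rotate_flatten_replicate (n k : ℕ) (l : List α) :
    (replicate k l).flatten.rotate n = (replicate k (l.rotate n)).flatten := by
  simp only [← rotateOne_iterate]
  induction n with
  | zero => rfl
  | succ n ih =>
    rw [Function.iterate_succ_apply', Function.iterate_succ_apply', ih,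
      rotateOne_flatten_replicate]

theorem length_flatten_replicate (k : ℕ) (l : List α) :
    (replicate k l).flatten.length = k * l.length := by simp

theorem flatten_replicate_injective {k : ℕ} (hk : k ≠ 0) :
    Function.Injective fun l : List α => (replicate k l).flatten := by
  intro l l' h
  obtain ⟨k, rfl⟩ := Nat.exists_eq_succ_of_ne_zero hk
  have hl : l.length = l'.length := by
    have := congrArg length h
    simpa [length_flatten_replicate] using this
  simp only [replicate_succ, flatten_cons] at h
  exact (append_inj h hl).1

/-- Rotation commutes with taking powers, and `k`-th powers of words are injective, so a word and
its power are fixed by the same rotations. -/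
theorem minimalPeriod_rotateOne_flatten_replicate {k : ℕ} (hk : k ≠ 0) (l : List α) :
    Function.minimalPeriod rotateOne (replicate k l).flatten
      = Function.minimalPeriod rotateOne l := by
  rw [Function.minimalPeriod_eq_minimalPeriod_iff]
  intro n
  rw [isPeriodicPt_rotateOne_iff, isPeriodicPt_rotateOne_iff, rotate_flatten_replicate]
  exact (flatten_replicate_injective hk).eq_iff

theorem eq_flatten_replicate_of_append_comm {a : List α} {c : ℕ} {b : List α}
    (hb : b.length = c * a.length) (h : a ++ b = b ++ a) : b = (replicate c a).flatten := by
  induction c generalizing b with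
  | zero => simpa using hb
  | succ c ih =>
    have hle : a.length ≤ b.length := by rw [hb]; nlinarith
    obtain ⟨b', rfl⟩ : a <+: b :=
      prefix_of_prefix_length_le (prefix_append a b) (h ▸ prefix_append b a) hle
    rw [replicate_succ, flatten_cons, ← ih]
    · simp only [length_append] at hb
      linarith [add_mul c 1 a.length]
    · simpa using h

/-- Invariance under rotation by `d` means that the prefix of length `d` commutes with the remaining
suffix, which forces the suffix to be a power of the prefix. -/
theorem eq_flatten_replicate_take {l : List α} {d q : ℕ} (hl : l.length = q * d)
    (h : l.rotate d = l) : l = (replicate q (l.take d)).flatten := by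
  cases q with
  | zero => simpa using hl
  | succ q =>
    have hd : d ≤ l.length := by rw [hl]; nlinarith
    have hlen : (l.take d).length = d := by simp [hd]
    rw [rotate_eq_drop_append_take hd] at h
    have := eq_flatten_replicate_of_append_comm (a := l.take d) (b := l.drop d) (c := q)
      (by rw [hlen, length_drop, hl, add_mul]; omega) (by rw [take_append_drop, h])
    rw [replicate_succ, flatten_cons, ← this, take_append_drop]

/-- Every nonempty word is a power of a word whose rotations are pairwise distinct. -/
theorem exists_eq_flatten_replicate (l : List α) (hl : l ≠ []) :
    ∃ (k : ℕ) (p : List α), k ≠ 0 ∧ p ≠ [] ∧ l = (replicate k p).flatten ∧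
      Function.minimalPeriod rotateOne p = p.length := by
  obtain ⟨q, hq⟩ := (isPeriodicPt_rotateOne_length l).minimalPeriod_dvd
  have hlen : 0 < l.length := length_pos_iff.2 hl
  rw [mul_comm] at hq
  have hq0 : q ≠ 0 := by rintro rfl; omega
  have hd0 : Function.minimalPeriod rotateOne l ≠ 0 := by intro h; rw [h] at hq; omega
  have hd : Function.minimalPeriod rotateOne l ≤ l.length := by
    rw [hq]; exact Nat.le_mul_of_pos_left _ (Nat.pos_of_ne_zero hq0)
  have e := eq_flatten_replicate_take hq
    (isPeriodicPt_rotateOne_iff.1 (Function.isPeriodicPt_minimalPeriod rotateOne l))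
  have hlen' : (l.take (Function.minimalPeriod rotateOne l)).length
      = Function.minimalPeriod rotateOne l := by simp [hd]
  refine ⟨q, _, hq0, ?_, e, ?_⟩
  · rw [← length_pos_iff, hlen']; omega
  · rw [hlen', ← minimalPeriod_rotateOne_flatten_replicate hq0, ← e]

end List

/-! ### Primitive cyclic words and unique primitive roots. -/

namespace Cycle

variable {α : Type*}

/-- A cyclic word is primitive if it is nonempty and not a proper power. -/
def IsPrimitive (C : Cycle α) : Prop :=
  C ≠ Cycle.nil ∧ ∀ (l : List α) (k : ℕ), 2 ≤ k →
    C ≠ ((List.replicate k l).flatten : Cycle α)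

/-- Taking a power keeps the minimal period but multiplies the length, so the period falls short of
the length exactly for proper powers. -/
theorem isPrimitive_coe_iff {l : List α} :
    IsPrimitive (l : Cycle α) ↔
      l ≠ [] ∧ Function.minimalPeriod List.rotateOne l = l.length := by
  rw [IsPrimitive, Ne, Cycle.coe_eq_nil]
  refine and_congr_right fun hl => ⟨fun h => ?_, fun h p k hk e => ?_⟩
  · obtain ⟨k, p, hk, -, rfl, hp⟩ := List.exists_eq_flatten_replicate l hl
    rw [List.minimalPeriod_rotateOne_flatten_replicate hk, hp]
    rcases (by omega : k = 1 ∨ 2 ≤ k) with rfl | hk2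
    · simp
    · exact absurd rfl (h p k hk2)
  · obtain ⟨n, hn⟩ := Cycle.coe_eq_coe.1 e
    have h1 := Function.minimalPeriod_apply_iterate
      (Function.mk_mem_periodicPts (List.length_pos_iff.2 hl)
        (List.isPeriodicPt_rotateOne_length l)) n
    rw [List.rotateOne_iterate, hn,
      List.minimalPeriod_rotateOne_flatten_replicate (by omega), h] at h1
    have h2 : l.length = k * p.length := by
      rw [← List.length_flatten_replicate, ← hn, List.length_rotate]
    have hpos : 0 < l.length := List.length_pos_iff.2 hl
    have hp : p ≠ [] := by rintro rfl; exact hl (List.length_eq_zero_iff.1 (by simpa using h2))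
    have h3 := (List.isPeriodicPt_rotateOne_length p).minimalPeriod_le
      (List.length_pos_iff.2 hp)
    have : 0 < p.length := List.length_pos_iff.2 hp
    nlinarith

/-- Powers of the rotations of the representatives of the primitive cyclic words. -/
noncomputable def powerWord
    (x : (Σ C : {C : Cycle α // C.IsPrimitive}, Fin C.1.length) × ℕ) : List α :=
  (List.replicate (x.2 + 1) ((Quotient.out x.1.1.1 : List α).rotate x.1.2)).flatten

theorem coe_out (C : Cycle α) : ((Quotient.out C : List α) : Cycle α) = C :=
  Quotient.out_eq C

theorem length_out (C : Cycle α) : (Quotient.out C : List α).length = C.length := by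
  conv_rhs => rw [← coe_out C]
  rfl

/-- All data can be read off the word: its minimal period is the length of the root, its length then
gives the exponent, cancelling the power gives the rotated root, and rotations by less than the
minimal period are distinct. -/
theorem powerWord_injective : Function.Injective (powerWord (α := α)) := by
  rintro ⟨⟨⟨C, hC⟩, i⟩, k⟩ ⟨⟨⟨C', hC'⟩, i'⟩, k'⟩ h
  have prim : ∀ (C : Cycle α), C.IsPrimitive → ∀ n : ℕ,
      Function.minimalPeriod List.rotateOne ((Quotient.out C : List α).rotate n) = C.length := by
    intro C hC n
    rw [← coe_out C, isPrimitive_coe_iff] at hC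
    rw [← List.rotateOne_iterate, Function.minimalPeriod_apply_iterate
      (Function.mk_mem_periodicPts (List.length_pos_iff.2 hC.1)
        (List.isPeriodicPt_rotateOne_length _)), hC.2, length_out]
  simp only [powerWord] at h
  have hmp := congrArg (Function.minimalPeriod List.rotateOne) h
  rw [List.minimalPeriod_rotateOne_flatten_replicate (Nat.succ_ne_zero _),
    List.minimalPeriod_rotateOne_flatten_replicate (Nat.succ_ne_zero _), prim C hC,
    prim C' hC'] at hmp
  have hlen := congrArg List.length h
  rw [List.length_flatten_replicate, List.length_flatten_replicate, List.length_rotate,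
    List.length_rotate, length_out, length_out, hmp] at hlen
  have hpos : 0 < C'.length := lt_of_le_of_lt (Nat.zero_le _) i'.2
  obtain rfl : k = k' := by simpa using Nat.eq_of_mul_eq_mul_right hpos hlen
  have h1 := List.flatten_replicate_injective (Nat.succ_ne_zero k) h
  obtain rfl : C = C' := by
    rw [← coe_out C, ← coe_out C', Cycle.coe_eq_coe]
    exact (List.IsRotated.forall _ _).symm.trans 
      (by rw [h1]; exact List.IsRotated.forall _ _)
  have h2 : (i : ℕ) = i' := by
    have inj := Function.iterate_injOn_Iio_minimalPeriod (f := List.rotateOne)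
      (x := (Quotient.out C : List α))
    have hp := prim C hC 0
    rw [List.rotate_zero] at hp
    rw [hp] at inj
    refine inj i.2 i'.2 ?_
    simpa only [List.rotateOne_iterate] using h1
  obtain rfl : i = i' := Fin.ext h2
  rfl

theorem range_powerWord : Set.range (powerWord (α := α)) = {l | l ≠ []} := by
  ext l
  constructor
  · rintro ⟨⟨⟨C, i⟩, k⟩, rfl⟩
    rw [Set.mem_ofPred_eq, ← List.length_pos_iff, powerWord, List.length_flatten_replicate,
      List.length_rotate, length_out]
    exact Nat.mul_pos (Nat.succ_pos _) (lt_of_le_of_lt (Nat.zero_le _) i.2)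
  · intro hl
    obtain ⟨k, p, hk, hp, rfl, hmp⟩ := List.exists_eq_flatten_replicate l hl
    obtain ⟨k, rfl⟩ := Nat.exists_eq_succ_of_ne_zero hk
    have hC : IsPrimitive (p : Cycle α) := isPrimitive_coe_iff.2 ⟨hp, hmp⟩
    obtain ⟨n, hn⟩ : (Quotient.out (p : Cycle α) : List α) ~r p :=
      Cycle.coe_eq_coe.1 (coe_out _)
    have hpos : 0 < (p : Cycle α).length := List.length_pos_iff.2 hp
    refine ⟨⟨⟨⟨p, hC⟩, ⟨n % (p : Cycle α).length, Nat.mod_lt _ hpos⟩⟩, k⟩, ?_⟩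
    simp only [powerWord]
    rw [← length_out, List.rotate_mod, hn]

end Cycle

/-! ### Determinants and traces through eigenvalues. -/

namespace Matrix

section Eigenvalues

variable {n : Type*} [Fintype n] [DecidableEq n]

theorem exists_charpoly_eq_prod {K : Type*} [Field K] [IsAlgClosed K] (M : Matrix n n K) :
    ∃ (N : ℕ) (μ : Fin N → K), M.charpoly = ∏ i, (Polynomial.X - Polynomial.C (μ i)) := by
  refine ⟨_, M.charpoly.roots.toList.get, ?_⟩
  have h := (IsAlgClosed.splits M.charpoly).eq_prod_roots_of_monic M.charpoly_monic
  conv_lhs => rw [h, ← Multiset.coe_toList M.charpoly.roots, Multiset.map_coe,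
    Multiset.prod_coe]
  rw [← List.prod_ofFn]
  congr 1
  conv_lhs => rw [← List.ofFn_get M.charpoly.roots.toList, List.map_ofFn]
  rfl

/-- Both sides are multiplicative in `p`, and `p` splits; for a linear factor `X - a` the claim is
the value of the characteristic polynomial at `a`, up to sign. No triangular form is needed. -/
theorem det_aeval_eq_prod {K : Type*} [Field K] [IsAlgClosed K] (M : Matrix n n K) {N : ℕ}
    {μ : Fin N → K} (h : M.charpoly = ∏ i, (Polynomial.X - Polynomial.C (μ i))) (p : K[X]) :
    (Polynomial.aeval M p).det = ∏ i, p.eval (μ i) := by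
  have hN : N = Fintype.card n := by
    have := congrArg Polynomial.natDegree h
    rwa [charpoly_natDegree_eq_dim, Polynomial.natDegree_finsetProd_X_sub_C_eq_card,
      Finset.card_univ, Fintype.card_fin, eq_comm] at this
  have hlin : ∀ a : K, (Polynomial.aeval M (Polynomial.X - Polynomial.C a)).det
      = ∏ i, (Polynomial.X - Polynomial.C a).eval (μ i) := by
    intro a
    have h1 := congrArg (Polynomial.eval a) h
    rw [eval_charpoly, Polynomial.eval_prod] at h1
    have h2 : Polynomial.aeval M (Polynomial.X - Polynomial.C a) = -(scalar n a - M) := by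
      rw [map_sub, Polynomial.aeval_X, Polynomial.aeval_C, neg_sub]; rfl
    have h3 : (-1 : K) ^ N = ∏ _i : Fin N, (-1 : K) := by simp
    rw [h2, det_neg, h1, ← hN, h3, ← Finset.prod_mul_distrib]
    simp
  rw [(IsAlgClosed.splits p).eq_prod_roots, map_mul, det_mul, Polynomial.aeval_C,
    Algebra.algebraMap_eq_smul_one, det_smul, det_one, mul_one]
  simp only [Polynomial.eval_mul, Polynomial.eval_C, Finset.prod_mul_distrib,
    Finset.prod_const, Finset.card_univ, Fintype.card_fin, hN]
  congr 1
  induction p.roots using Multiset.induction_on with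
  | empty => simp
  | cons a s ih =>
    rw [Multiset.map_cons, Multiset.prod_cons, map_mul, det_mul, hlin, ih,
      ← Finset.prod_mul_distrib]
    simp only [Polynomial.eval_mul]

theorem trace_pow_eq_sum {K : Type*} [Field K] [IsAlgClosed K] (M : Matrix n n K) {N : ℕ}
    {μ : Fin N → K} (h : M.charpoly = ∏ i, (Polynomial.X - Polynomial.C (μ i))) (k : ℕ) :
    (M ^ k).trace = ∑ i, μ i ^ k := by
  have hpow : (M ^ k).charpoly = ∏ i, (Polynomial.X - Polynomial.C (μ i ^ k)) := by
    have : Infinite K := IsAlgClosed.instInfinite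
    refine Polynomial.funext fun a => ?_
    -- For `p = a - X ^ k` the determinant is the characteristic polynomial of `M ^ k` at `a`.
    have h1 := det_aeval_eq_prod M h (Polynomial.C a - Polynomial.X ^ k)
    rw [eval_charpoly, Polynomial.eval_prod]
    simp only [Polynomial.eval_sub, Polynomial.eval_X, Polynomial.eval_C, Polynomial.eval_pow]
      at h1 ⊢
    rw [← h1, map_sub, map_pow, Polynomial.aeval_X, Polynomial.aeval_C]
    rfl
  have hroots := Polynomial.roots_multiset_prod_X_sub_C
    (Finset.univ.val.map fun i => μ i ^ k)
  rw [Multiset.map_map] at hroots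
  rw [trace_eq_sum_roots_charpoly, hpow, Finset.prod_eq_multiset_prod, Finset.sum_eq_multiset_sum]
  exact congrArg Multiset.sum hroots

theorem det_one_sub_smul_eq_prod {K : Type*} [Field K] [IsAlgClosed K] (M : Matrix n n K) {N : ℕ}
    {μ : Fin N → K} (h : M.charpoly = ∏ i, (Polynomial.X - Polynomial.C (μ i))) (z : K) :
    (1 - z • M).det = ∏ i, (1 - z * μ i) := by
  have := det_aeval_eq_prod M h (1 - Polynomial.C z * Polynomial.X)
  simpa [Algebra.algebraMap_eq_smul_one] using this

end Eigenvalues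

/-! ### Weights of cyclic words and traces of powers. -/

section WordWeight

variable {α : Type*} {R : Type*} [CommRing R]

/-- The product of the entries of `W` along a cyclically read word. -/
def wordWeight (W : Matrix α α R) (l : List α) : R := (List.zipWith (fun i j => W i j) l (l.rotate 1)).prod

/-- The product of the entries of `W` along a cyclic word. -/
def cycleWeight (W : Matrix α α R) (C : Cycle α) : R :=
  Quotient.liftOn' C (wordWeight W) (by
    rintro l _ ⟨n, rfl⟩
    unfold wordWeight
    rw [List.rotate_rotate, Nat.add_comm n 1, ← List.rotate_rotate,
      ← List.zipWith_rotate_distrib _ _ _ _ (by simp)]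
    exact ((List.rotate_perm _ n).prod_eq).symm)

theorem cycleWeight_coe (W : Matrix α α R) (l : List α) :
    cycleWeight W (l : Cycle α) = wordWeight W l := rfl

theorem wordWeight_rotate (W : Matrix α α R) (l : List α) (n : ℕ) :
    wordWeight W (l.rotate n) = wordWeight W l := by
  rw [← cycleWeight_coe, ← cycleWeight_coe]
  congr 1
  exact Cycle.coe_eq_coe.2 (List.IsRotated.forall l n)

theorem wordWeight_flatten_replicate (W : Matrix α α R) (k : ℕ) (l : List α) :
    wordWeight W (List.replicate k l).flatten = wordWeight W l ^ k := by
  rw [wordWeight, List.rotate_flatten_replicate, wordWeight]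
  generalize hm : l.rotate 1 = m
  have hlen : l.length = m.length := by rw [← hm, List.length_rotate]
  induction k with
  | zero => simp
  | succ k ih =>
    rw [List.replicate_succ, List.replicate_succ, List.flatten_cons, List.flatten_cons,
      List.zipWith_append hlen, List.prod_append, ih, pow_succ']

theorem wordWeight_smul (W : Matrix α α R) (z : R) (l : List α) :
    wordWeight (z • W) l = z ^ l.length * wordWeight W l := by
  rw [wordWeight, wordWeight]
  have : ∀ l m : List α, l.length = m.length →
      (List.zipWith (fun i j => (z • W) i j) l m).prod = z ^ l.length * (List.zipWith (fun i j => W i j) l m).prod := by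
    intro l
    induction l with
    | nil => simp
    | cons a l ih =>
      rintro (_ | ⟨b, m⟩) h
      · simp at h
      · simp only [List.zipWith_cons_cons, List.prod_cons, List.length_cons]
        rw [ih m (by simpa using h), Matrix.smul_apply, smul_eq_mul, pow_succ]
        ring
  exact this _ _ (by simp)

theorem cycleWeight_smul (W : Matrix α α R) (z : R) (C : Cycle α) :
    cycleWeight (z • W) C = z ^ C.length * cycleWeight W C := by
  induction C using Quotient.inductionOn' with
  | h l => exact wordWeight_smul W z l

theorem wordWeight_powerWord (W : Matrix α α R)
    (x : (Σ C : {C : Cycle α // C.IsPrimitive}, Fin C.1.length) × ℕ) :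
    wordWeight W (Cycle.powerWord x) = cycleWeight W x.1.1.1 ^ (x.2 + 1) := by
  rw [Cycle.powerWord, wordWeight_flatten_replicate, wordWeight_rotate, ← cycleWeight_coe,
    Cycle.coe_out]

variable [Fintype α] [DecidableEq α]

/-- The word `v` lists the `n` intermediate indices of a path of `n + 1` steps from `a` to `b`. -/
theorem sum_path_eq_pow (W : Matrix α α R) (n : ℕ) (a b : α) :
    ∑ v : Fin n → α, (List.zipWith (fun i j => W i j) (a :: List.ofFn v) (List.ofFn v ++ [b])).prod
      = (W ^ (n + 1)) a b := by
  induction n generalizing a with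
  | zero => simp
  | succ n ih =>
    rw [pow_succ' W (n + 1), Matrix.mul_apply, ← (Fin.consEquiv fun _ => α).sum_comp,
      Fintype.sum_prod_type]
    refine Finset.sum_congr rfl fun c _ => ?_
    rw [← ih c, Finset.mul_sum]
    refine Finset.sum_congr rfl fun v _ => ?_
    simp [Fin.consEquiv, List.ofFn_succ]

theorem sum_wordWeight_eq_trace (W : Matrix α α R) (n : ℕ) :
    ∑ v : Fin (n + 1) → α, wordWeight W (List.ofFn v) = (W ^ (n + 1)).trace := by
  rw [← (Fin.consEquiv fun _ => α).sum_comp, Fintype.sum_prod_type, Matrix.trace]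
  refine Finset.sum_congr rfl fun c _ => ?_
  rw [Matrix.diag_apply, ← sum_path_eq_pow]
  refine Finset.sum_congr rfl fun v _ => ?_
  simp [Fin.consEquiv, List.ofFn_succ, wordWeight]

end WordWeight

/-! ### Amitsur's identity for small matrices. -/

section Analytic

variable {α : Type*}

theorem norm_wordWeight_le {W : Matrix α α ℂ} {r : ℝ} (hW : ∀ i j, ‖W i j‖ ≤ r) (l : List α) :
    ‖wordWeight W l‖ ≤ r ^ l.length := by
  have : ∀ l m : List α, l.length = m.length → ‖(List.zipWith (fun i j => W i j) l m).prod‖ ≤ r ^ l.length := by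
    intro l
    induction l with
    | nil => simp
    | cons a l ih =>
      rintro (_ | ⟨b, m⟩) h
      · simp at h
      · simp only [List.zipWith_cons_cons, List.prod_cons, List.length_cons, norm_mul]
        rw [pow_succ']
        exact mul_le_mul (hW a b) (ih m (by simpa using h)) (norm_nonneg _)
          ((norm_nonneg _).trans (hW a b))
  exact this _ _ (by simp)

variable [Fintype α]

/-- The `card α ^ n` words of length `n` are dominated by a geometric series of ratio `card α * r`.
-/
theorem summable_norm_wordWeight {W : Matrix α α ℂ} {r : ℝ} (hr : 0 ≤ r)
    (hW : ∀ i j, ‖W i j‖ ≤ r) (hr' : Fintype.card α * r < 1) :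
    Summable fun l => ‖wordWeight W l‖ := by
  have hs : Summable fun l : List α => r ^ l.length := by
    rw [← (List.equivSigmaTuple (α := α)).symm.summable_iff]
    refine (summable_sigma_of_nonneg fun x => pow_nonneg hr _).2
      ⟨fun n => Summable.of_finite, ?_⟩
    refine (summable_geometric_of_lt_one (by positivity) hr').congr fun n => ?_
    simp [List.equivSigmaTuple, tsum_fintype, mul_pow]
  exact hs.of_nonneg_of_le (fun _ => norm_nonneg _) (norm_wordWeight_le hW)

theorem summable_norm_cycleWeight {W : Matrix α α ℂ} {r : ℝ} (hr : 0 ≤ r)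
    (hW : ∀ i j, ‖W i j‖ ≤ r) (hr' : Fintype.card α * r < 1) :
    Summable fun C : {C : Cycle α // C.IsPrimitive} => ‖cycleWeight W C.1‖ := by
  have := (summable_norm_wordWeight hr hW hr').comp_injective
    (i := fun C : {C : Cycle α // C.IsPrimitive} => (Quotient.out C.1 : List α))
    (fun C C' h => Subtype.ext (Quotient.out_injective h))
  refine this.congr fun C => ?_
  simp only [Function.comp]
  rw [← cycleWeight_coe, Cycle.coe_out]

theorem hasSum_pow_succ_div {z : ℂ} (hz : ‖z‖ < 1) :
    HasSum (fun n : ℕ => z ^ (n + 1) / ((n : ℂ) + 1)) (-Complex.log (1 - z)) := by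
  have := (hasSum_nat_add_iff' 1).2 (Complex.hasSum_taylorSeries_neg_log hz)
  simpa using this

variable [DecidableEq α]

/-- Amitsur's identity for a matrix with small entries and eigenvalues. -/
theorem hasProd_one_sub_cycleWeight_of_small {W : Matrix α α ℂ} {r : ℝ} (hr : 0 ≤ r)
    (hr1 : r < 1) (hW : ∀ i j, ‖W i j‖ ≤ r) (hr' : Fintype.card α * r < 1) {N : ℕ}
    {μ : Fin N → ℂ} (h : W.charpoly = ∏ i, (Polynomial.X - Polynomial.C (μ i)))
    (hμ : ∀ i, ‖μ i‖ < 1) :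
    HasProd (fun C : {C : Cycle α // C.IsPrimitive} => 1 - cycleWeight W C.1) (1 - W).det := by
  -- The empty word has weight `1` and length `0`; division by zero makes its term `0`, so it drops
  -- out of both summations.
  set g : List α → ℂ := fun l => wordWeight W l / l.length with hg
  have hgs : Summable g := by
    refine Summable.of_norm ((summable_norm_wordWeight hr hW hr').of_nonneg_of_le
      (fun _ => norm_nonneg _) fun l => ?_)
    rw [hg, norm_div, Complex.norm_natCast]
    rcases Nat.eq_zero_or_pos l.length with h0 | h0
    · simp [h0]
    · exact div_le_self (norm_nonneg _) (by exact_mod_cast h0)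
  have hw : ∀ C : {C : Cycle α // C.IsPrimitive}, ‖cycleWeight W C.1‖ < 1 := by
    intro C
    rw [← Cycle.coe_out C.1, cycleWeight_coe]
    have hC := C.2
    rw [← Cycle.coe_out C.1, Cycle.isPrimitive_coe_iff] at hC
    exact (norm_wordWeight_le hW _).trans_lt
      (pow_lt_one₀ hr hr1 (List.length_pos_iff.2 hC.1).ne')
  -- summation by length
  have h1 : HasSum g (∑ i, -Complex.log (1 - μ i)) := by
    have e := (List.equivSigmaTuple (α := α)).symm.hasSum_iff (f := g) (a := ∑' l, g l)
    have hs := (e.2 hgs.hasSum).sigma (fun n => hasSum_fintype _)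
    have hs' := (hasSum_nat_add_iff' 1).2 hs
    have hz : ∀ v : Fin 0 → α, g (List.ofFn v) = 0 := by simp [hg]
    simp only [Finset.range_one, Finset.sum_singleton, Function.comp, List.equivSigmaTuple,
      Equiv.coe_fn_symm_mk, hz, Finset.sum_const_zero, sub_zero] at hs'
    have ht : HasSum (fun n : ℕ => ∑ i, μ i ^ (n + 1) / ((n : ℂ) + 1))
        (∑ i, -Complex.log (1 - μ i)) := hasSum_sum fun i _ => hasSum_pow_succ_div (hμ i)
    have he : (∑' l, g l) = ∑ i, -Complex.log (1 - μ i) := by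
      refine hs'.unique (ht.congr_fun ?_)
      intro n
      simp only [hg, List.length_ofFn]
      rw [← Finset.sum_div, ← Finset.sum_div, sum_wordWeight_eq_trace, trace_pow_eq_sum W h]
      push_cast
      rfl
    exact he ▸ hgs.hasSum
  -- summation by primitive root
  have h2 : HasSum (fun C : {C : Cycle α // C.IsPrimitive} =>
      -Complex.log (1 - cycleWeight W C.1)) (∑ i, -Complex.log (1 - μ i)) := by
    have hinj := Cycle.powerWord_injective (α := α)
    have hp : HasSum (g ∘ Cycle.powerWord) (∑ i, -Complex.log (1 - μ i)) := by
      refine (hinj.hasSum_iff ?_).2 h1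
      intro l hl
      rw [Cycle.range_powerWord, Set.mem_ofPred_eq, not_not] at hl
      simp [hg, hl]
    have hfib : ∀ x : (Σ C : {C : Cycle α // C.IsPrimitive}, Fin C.1.length),
        HasSum (fun k : ℕ => (g ∘ Cycle.powerWord) (x, k))
          (-Complex.log (1 - cycleWeight W x.1.1) / x.1.1.length) := by
      intro x
      have := (hasSum_pow_succ_div (hw x.1)).div_const (x.1.1.length : ℂ)
      refine this.congr_fun fun k => ?_
      simp only [Function.comp, hg]
      rw [wordWeight_powerWord, Cycle.powerWord, List.length_flatten_replicate,
        List.length_rotate, Cycle.length_out, div_div]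
      push_cast
      rfl
    have := (hp.prod_fiberwise hfib).sigma (fun C => hasSum_fintype _)
    refine this.congr_fun fun C => ?_
    -- The `C.1.length` rotations of a primitive root contribute equally and cancel the remaining
    -- denominator.
    simp only [Finset.sum_const, Finset.card_univ, Fintype.card_fin, nsmul_eq_mul]
    have hpos : (C.1.length : ℂ) ≠ 0 := by
      have hC := C.2
      rw [← Cycle.coe_out C.1, Cycle.isPrimitive_coe_iff] at hC
      rw [← Cycle.length_out]
      exact_mod_cast (List.length_pos_iff.2 hC.1).ne'
    field_simp
  have hne : ∀ w : ℂ, ‖w‖ < 1 → 1 - w ≠ 0 := by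
    intro w hw h0
    rw [← sub_eq_zero.1 h0] at hw
    simp at hw
  -- Logarithms occur only under the exponential, so the choice of branch does not matter.
  have hdet : (1 - W).det = Complex.exp (-∑ i, -Complex.log (1 - μ i)) := by
    have := det_one_sub_smul_eq_prod W h 1
    rw [one_smul] at this
    rw [this, ← Finset.sum_neg_distrib, Complex.exp_sum]
    refine Finset.prod_congr rfl fun i _ => ?_
    rw [neg_neg, one_mul, Complex.exp_log (hne _ (hμ i))]
  rw [hdet]
  have := h2.neg.cexp
  refine this.congr_fun fun C => ?_
  simp [Complex.exp_log (hne _ (hw C))]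

end Analytic

end Matrix

/-! ### Continuation of Amitsur's identity to all absolutely convergent products. -/

namespace Matrix

section Continuation

variable {α : Type*} [Fintype α] [DecidableEq α]

theorem charpoly_smul_eq_prod {K : Type*} [Field K] [IsAlgClosed K] (M : Matrix α α K) {N : ℕ}
    {μ : Fin N → K} (h : M.charpoly = ∏ i, (Polynomial.X - Polynomial.C (μ i))) (z : K) :
    (z • M).charpoly = ∏ i, (Polynomial.X - Polynomial.C (z * μ i)) := by
  have : Infinite K := IsAlgClosed.instInfinite
  refine Polynomial.funext fun a => ?_
  have h1 := det_aeval_eq_prod M h (Polynomial.C a - Polynomial.C z * Polynomial.X)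
  rw [eval_charpoly, Polynomial.eval_prod]
  simp only [Polynomial.eval_sub, Polynomial.eval_X, Polynomial.eval_C, Polynomial.eval_mul]
    at h1 ⊢
  rw [← h1, map_sub, map_mul, Polynomial.aeval_X, Polynomial.aeval_C, Polynomial.aeval_C,
    ← Algebra.smul_def]
  rfl

omit [DecidableEq α] in
theorem exists_norm_apply_le (W : Matrix α α ℂ) : ∃ M : ℝ, 0 ≤ M ∧ ∀ i j, ‖W i j‖ ≤ M := by
  refine ⟨∑ i, ∑ j, ‖W i j‖, by positivity, fun i j => ?_⟩
  exact (Finset.single_le_sum (f := fun j => ‖W i j‖) (fun _ _ => norm_nonneg _)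
    (Finset.mem_univ j)).trans
    (Finset.single_le_sum (f := fun i => ∑ j, ‖W i j‖)
      (fun _ _ => Finset.sum_nonneg fun _ _ => norm_nonneg _) (Finset.mem_univ i))

theorem eventually_hasProd_one_sub_cycleWeight (W : Matrix α α ℂ) :
    ∀ᶠ z in 𝓝 (0 : ℂ),
      HasProd (fun C : {C : Cycle α // C.IsPrimitive} => 1 - cycleWeight (z • W) C.1)
        (1 - z • W).det := by
  obtain ⟨M, hM, hW⟩ := exists_norm_apply_le W
  obtain ⟨N, μ, hμ⟩ := exists_charpoly_eq_prod W
  have h1 : ∀ᶠ z in 𝓝 (0 : ℂ), ‖z‖ * M < 1 :=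
    (Continuous.tendsto' (by fun_prop) 0 0 (by simp)).eventually_lt_const one_pos
  have h2 : ∀ᶠ z in 𝓝 (0 : ℂ), Fintype.card α * (‖z‖ * M) < 1 :=
    (Continuous.tendsto' (by fun_prop) 0 0 (by simp)).eventually_lt_const one_pos
  have h3 : ∀ᶠ z in 𝓝 (0 : ℂ), ∀ i, ‖z * μ i‖ < 1 := Filter.eventually_all.2 fun i =>
    (Continuous.tendsto' (by fun_prop) 0 0 (by simp)).eventually_lt_const one_pos
  filter_upwards [h1, h2, h3] with z h1 h2 h3
  refine hasProd_one_sub_cycleWeight_of_small (by positivity) h1 (fun i j => ?_) h2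
    (charpoly_smul_eq_prod W hμ z) h3
  rw [Matrix.smul_apply, norm_smul]
  exact mul_le_mul_of_nonneg_left (hW i j) (norm_nonneg z)

/-- Amitsur's identity: the product over the primitive cyclic words, wherever it converges
absolutely. -/
theorem tprod_one_sub_cycleWeight {W : Matrix α α ℂ}
    (hs : Summable fun C : {C : Cycle α // C.IsPrimitive} => ‖cycleWeight W C.1‖) :
    ∏' C : {C : Cycle α // C.IsPrimitive}, (1 - cycleWeight W C.1) = (1 - W).det := by
  set f : {C : Cycle α // C.IsPrimitive} → ℂ → ℂ := fun C z => -(z ^ C.1.length * cycleWeight W C.1)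
    with hf
  set F : ℂ → ℂ := fun z => ∏' C, (1 + f C z) with hF
  have hbound : ∀ z : ℂ, ‖z‖ ≤ 1 → ∀ C, ‖f C z‖ ≤ ‖cycleWeight W C.1‖ := by
    intro z hz C
    rw [hf, norm_neg, norm_mul, norm_pow]
    exact mul_le_of_le_one_left (norm_nonneg _) (pow_le_one₀ (norm_nonneg _) hz)
  have hball : ∀ z ∈ Metric.ball (0 : ℂ) 1, ‖z‖ ≤ 1 := fun z hz =>
    (mem_ball_zero_iff.1 hz).le
  -- Expanding the product over finite sets of cycles gives a series of polynomials in `z`,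
  -- dominated on the unit disc by a summable series independent of `z`.
  have hdiff : DifferentiableOn ℂ F (Metric.ball 0 1) := by
    have hS : ∀ z ∈ Metric.ball (0 : ℂ) 1, F z = ∑' s : Finset _, ∏ C ∈ s, f C z := by
      intro z hz
      exact tprod_one_add (summable_finsetProd_of_summable_norm
        (hs.of_nonneg_of_le (fun _ => norm_nonneg _) (hbound z (hball z hz))))
    refine DifferentiableOn.congr ?_ hS
    refine Complex.differentiableOn_tsum_of_summable_norm
      (summable_finsetProd_of_summable_nonneg (fun _ => norm_nonneg _) hs)
      (fun s => by fun_prop) Metric.isOpen_ball fun s z hz => ?_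
    rw [norm_prod]
    exact Finset.prod_le_prod (fun _ _ => norm_nonneg _) fun C _ => hbound z (hball z hz) C
  have hdet : Differentiable ℂ fun z : ℂ => (1 - z • W).det := by
    obtain ⟨N, μ, hμ⟩ := exists_charpoly_eq_prod W
    simp only [det_one_sub_smul_eq_prod W hμ]
    fun_prop
  have hterm : ∀ z : ℂ, F z = ∏' C : {C : Cycle α // C.IsPrimitive},
      (1 - cycleWeight (z • W) C.1) := by
    intro z
    simp only [hF, hf, cycleWeight_smul, sub_eq_add_neg]
  have heq : Set.EqOn F (fun z => (1 - z • W).det) (Metric.ball 0 1) := by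
    refine (hdiff.analyticOnNhd Metric.isOpen_ball).eqOn_of_preconnected_of_eventuallyEq
      (hdet.differentiableOn.analyticOnNhd Metric.isOpen_ball)
      (convex_ball (0 : ℂ) 1).isPreconnected (Metric.mem_ball_self one_pos) ?_
    filter_upwards [eventually_hasProd_one_sub_cycleWeight W] with z hz
    rw [hterm, hz.tprod_eq]
  -- The wanted point `z = 1` lies on the boundary, and convergence beyond it is not given; it is
  -- reached as a limit from inside, by dominated convergence.
  have hcl : (1 : ℂ) ∈ closure (Metric.ball (0 : ℂ) 1) := by
    rw [closure_ball _ one_ne_zero]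
    simp
  have : (𝓝[Metric.ball (0 : ℂ) 1] 1).NeBot := mem_closure_iff_nhdsWithin_neBot.1 hcl
  have hlim1 : Filter.Tendsto F (𝓝[Metric.ball (0 : ℂ) 1] 1) (𝓝 (F 1)) := by
    refine tendsto_tprod_one_add_of_dominated_convergence hs (fun C => ?_) ?_
    · refine (Continuous.tendsto ?_ 1).mono_left nhdsWithin_le_nhds
      fun_prop
    · filter_upwards [self_mem_nhdsWithin] with z hz using hbound z (hball z hz)
  have hlim2 : Filter.Tendsto F (𝓝[Metric.ball (0 : ℂ) 1] 1) (𝓝 (1 - (1 : ℂ) • W).det) := by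
    refine ((hdet.continuous.tendsto 1).mono_left nhdsWithin_le_nhds).congr' ?_
    filter_upwards [self_mem_nhdsWithin] with z hz using (heq hz).symm
  have := tendsto_nhds_unique hlim1 hlim2
  rw [hterm, one_smul] at this
  exact this

end Continuation

end Matrix

/-! ### Matrices on oriented edges and Bass' formula. -/

namespace SimpleGraph

section DartMatrices

variable {V : Type*} [DecidableEq V] (G : SimpleGraph V) (R : Type*) [CommRing R]

/-- The incidence matrix of vertices and the oriented edges that start there. -/
def dartStartMatrix : Matrix V G.Dart R := Matrix.of fun v e => if e.fst = v then 1 else 0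

/-- The incidence matrix of oriented edges and the vertices where they end. -/
def dartEndMatrix : Matrix G.Dart V R := Matrix.of fun e v => if e.snd = v then 1 else 0

/-- The permutation matrix of the inversion of oriented edges. -/
def dartSymmMatrix : Matrix G.Dart G.Dart R := Matrix.of fun e f => if f = e.symm then 1 else 0

variable {R}

theorem map_dartStartMatrix {S : Type*} [CommRing S] (φ : R →+* S) :
    (G.dartStartMatrix R).map φ = G.dartStartMatrix S := by
  ext; simp [dartStartMatrix, apply_ite φ]

theorem map_dartEndMatrix {S : Type*} [CommRing S] (φ : R →+* S) :
    (G.dartEndMatrix R).map φ = G.dartEndMatrix S := by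
  ext; simp [dartEndMatrix, apply_ite φ]

theorem map_dartSymmMatrix {S : Type*} [CommRing S] (φ : R →+* S) :
    (G.dartSymmMatrix R).map φ = G.dartSymmMatrix S := by
  ext; simp [dartSymmMatrix, apply_ite φ]

theorem sum_dart {V : Type*} [Fintype V] (G : SimpleGraph V) [DecidableRel G.Adj] {M : Type*}
    [AddCommMonoid M] (g : V → V → M) :
    ∑ e : G.Dart, g e.fst e.snd = ∑ v, ∑ w, if G.Adj v w then g v w else 0 := by
  rw [← Fintype.sum_prod_type', ← Finset.sum_filter]
  refine Finset.sum_bij (fun e _ => e.toProd) (fun e _ => by simp [e.adj])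
    (fun e _ f _ h => Dart.ext _ _ h) (fun p hp => ?_) (fun _ _ => rfl)
  exact ⟨⟨p, by simpa using hp⟩, Finset.mem_univ _, rfl⟩

variable [Fintype V]

theorem dartEndMatrix_mul_dartStartMatrix_apply (e f : G.Dart) :
    (G.dartEndMatrix R * G.dartStartMatrix R) e f = if e.snd = f.fst then 1 else 0 := by
  simp [Matrix.mul_apply, dartStartMatrix, dartEndMatrix, eq_comm]

variable [DecidableRel G.Adj]

theorem dartSymmMatrix_mul {β : Type*} (M : Matrix G.Dart β R) (e : G.Dart) (b : β) :
    (G.dartSymmMatrix R * M) e b = M e.symm b := by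
  simp [dartSymmMatrix, Matrix.mul_apply]

theorem dartSymmMatrix_mul_self : G.dartSymmMatrix R * G.dartSymmMatrix R = 1 := by
  ext e f
  rw [dartSymmMatrix_mul, dartSymmMatrix, Matrix.of_apply, Matrix.one_apply, Dart.symm_symm]
  simp only [eq_comm]

theorem dartStartMatrix_mul_dartEndMatrix :
    G.dartStartMatrix R * G.dartEndMatrix R = G.adjMatrix R := by
  ext v w
  simp only [Matrix.mul_apply, dartStartMatrix, dartEndMatrix, Matrix.of_apply, adjMatrix_apply]
  rw [G.sum_dart fun a b => (if a = v then (1 : R) else 0) * if b = w then 1 else 0]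
  rw [Finset.sum_eq_single v (fun a _ ha => by simp [ha]) (by simp),
    Finset.sum_eq_single w (fun a _ ha => by simp [ha]) (by simp)]
  simp

theorem dartStartMatrix_mul_dartSymmMatrix_mul_dartEndMatrix :
    G.dartStartMatrix R * (G.dartSymmMatrix R * G.dartEndMatrix R)
      = Matrix.diagonal fun v => (G.degree v : R) := by
  ext v w
  rw [Matrix.mul_apply]
  simp only [dartSymmMatrix_mul, dartStartMatrix, dartEndMatrix, Matrix.of_apply]
  refine (G.sum_dart fun a b => (if a = v then (1 : R) else 0) * if a = w then 1 else 0).trans ?_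
  rw [Finset.sum_eq_single v (fun a _ ha => by simp [ha]) (by simp), Matrix.diagonal_apply]
  by_cases h : v = w
  · simp [h, ← card_neighborFinset_eq_degree, neighborFinset_eq_filter]
  · simp [h]

/-- Orient each edge by an arbitrary order of the vertices and let `σ` be the resulting sign of a
dart. Inversion reverses the sign, so conjugation by `diag(σ)` turns the inversion matrix into its
negative. -/
theorem det_one_add_smul_dartSymmMatrix_eq (a : R) :
    (1 + a • G.dartSymmMatrix R).det = (1 - a • G.dartSymmMatrix R).det := by
  set σ : G.Dart → R := fun e =>
    if Fintype.equivFin V e.fst < Fintype.equivFin V e.snd then 1 else -1 with hσ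
  have hsq : ∀ e, σ e * σ e = 1 := fun e => by simp only [hσ]; split_ifs <;> simp
  have hsymm : ∀ e, σ e * σ e.symm = -1 := by
    intro e
    have hne : Fintype.equivFin V e.fst ≠ Fintype.equivFin V e.snd :=
      fun h => e.adj.ne ((Fintype.equivFin V).injective h)
    simp only [hσ, Dart.symm, Prod.fst_swap, Prod.snd_swap]
    rcases lt_or_gt_of_ne hne with h | h
    · simp [h, h.not_gt]
    · simp [h, h.not_gt]
  have hmul : Matrix.diagonal σ * (1 + a • G.dartSymmMatrix R) * Matrix.diagonal σ
      = 1 - a • G.dartSymmMatrix R := by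
    ext e f
    rw [Matrix.mul_diagonal, Matrix.diagonal_mul]
    simp only [Matrix.add_apply, Matrix.sub_apply, Matrix.smul_apply, Matrix.one_apply,
      dartSymmMatrix, Matrix.of_apply, smul_eq_mul]
    by_cases h1 : e = f
    · subst h1
      have : e ≠ e.symm := e.symm_ne.symm
      simp [this, hsq]
    · by_cases h2 : f = e.symm
      · subst h2
        simp only [h1, if_false, if_true, zero_add, mul_one, zero_sub]
        linear_combination a * hsymm e
      · simp [h1, h2]
  rw [← hmul, Matrix.det_mul, Matrix.det_mul, Matrix.det_diagonal, mul_right_comm,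
    ← Finset.prod_mul_distrib]
  simp [hsq]

theorem one_sub_mul_one_add_dartSymmMatrix (a : R) :
    (1 - a • G.dartSymmMatrix R) * (1 + a • G.dartSymmMatrix R)
      = (1 - a ^ 2) • (1 : Matrix G.Dart G.Dart R) := by
  rw [sub_mul, one_mul, mul_add, mul_one, Matrix.smul_mul, Matrix.mul_smul,
    dartSymmMatrix_mul_self, smul_smul, sub_smul, one_smul, pow_two]
  abel

theorem det_one_add_smul_dartSymmMatrix_sq (a : R) :
    (1 + a • G.dartSymmMatrix R).det ^ 2 = ((1 - a ^ 2) ^ G.edgeFinset.card) ^ 2 := by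
  conv_lhs => rw [pow_two]; arg 1; rw [det_one_add_smul_dartSymmMatrix_eq]
  rw [← Matrix.det_mul, one_sub_mul_one_add_dartSymmMatrix, Matrix.det_smul, Matrix.det_one, mul_one,
    dart_card_eq_twice_card_edges, pow_mul']

theorem map_det_one_add_smul_dartSymmMatrix {S : Type*} [CommRing S] (φ : R →+* S) (a : R) :
    φ (1 + a • G.dartSymmMatrix R).det = (1 + φ a • G.dartSymmMatrix S).det := by
  rw [RingHom.map_det, map_add, map_one, RingHom.mapMatrix_apply, ← G.map_dartSymmMatrix φ]
  congr 2
  ext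
  simp

/-- The square of the determinant is known. In the domain `ℤ[X]` this fixes it up to sign, the value
at `0` settles the sign, and specialization of `X` reaches any commutative ring. -/
theorem det_one_add_smul_dartSymmMatrix (a : R) :
    (1 + a • G.dartSymmMatrix R).det = (1 - a ^ 2) ^ G.edgeFinset.card := by
  have key : (1 + (Polynomial.X : ℤ[X]) • G.dartSymmMatrix ℤ[X]).det
      = (1 - Polynomial.X ^ 2) ^ G.edgeFinset.card := by
    rcases sq_eq_sq_iff_eq_or_eq_neg.1 (G.det_one_add_smul_dartSymmMatrix_sq (Polynomial.X : ℤ[X]))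
      with h | h
    · exact h
    · have h0 := congrArg (Polynomial.evalRingHom 0) h
      rw [map_det_one_add_smul_dartSymmMatrix] at h0
      norm_num at h0
  have := G.map_det_one_add_smul_dartSymmMatrix
    (Polynomial.eval₂RingHom (Int.castRingHom R) a) Polynomial.X
  rw [key, map_pow, map_sub, map_one, map_pow] at this
  simpa using this.symm

/-- The weighted edge matrix of the Bartholdi zeta function, `b = 1 - u`. -/
def bartholdiEdgeMatrix (b t : R) : Matrix G.Dart G.Dart R :=
  t • (G.dartEndMatrix R * G.dartStartMatrix R - b • G.dartSymmMatrix R)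

/-- The vertex matrix of the Bartholdi zeta function, `b = 1 - u`. -/
def bartholdiVertexMatrix (b t : R) : Matrix V V R :=
  -t • G.adjMatrix R
    + Matrix.diagonal fun v => (1 - b ^ 2 * t ^ 2) + b * t ^ 2 * (G.degree v : R)

theorem smul_one_sub_mul_comm_det {m n : Type*} [Fintype m] [DecidableEq m] [Fintype n]
    [DecidableEq n] (s : R) (A : Matrix m n R) (B : Matrix n m R) :
    s ^ Fintype.card n * (s • (1 : Matrix m m R) - A * B).det
      = s ^ Fintype.card m * (s • (1 : Matrix n n R) - B * A).det := by
  have := congrArg (Polynomial.eval s) (Matrix.charpoly_mul_comm' A B)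
  simpa [Matrix.eval_charpoly, Matrix.scalar_apply, Matrix.smul_one_eq_diagonal] using this

/-- With `J` the inversion matrix, multiplying `1 - W` by `1 - b t J` leaves `s • 1` minus a product
through the vertices. Exchanging its two factors produces the vertex matrix. As there are twice as
many darts as edges, `s ^ m` cancels, with `m` the number of edges. -/
theorem pow_mul_det_one_sub_bartholdiEdgeMatrix [IsDomain R] {b t : R} (hs : 1 - b ^ 2 * t ^ 2 ≠ 0) :
    (1 - b ^ 2 * t ^ 2) ^ Fintype.card V * (1 - G.bartholdiEdgeMatrix b t).det
      = (1 - b ^ 2 * t ^ 2) ^ G.edgeFinset.card * (G.bartholdiVertexMatrix b t).det := by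
  set s := 1 - b ^ 2 * t ^ 2 with hsdef
  have hs2 : 1 - (b * t) ^ 2 = s := by rw [hsdef, mul_pow]
  set J := G.dartSymmMatrix R with hJ
  set P : Matrix G.Dart V R := t • (G.dartEndMatrix R - (b * t) • (J * G.dartEndMatrix R)) with hP
  have h1 : (1 - (b * t) • J) * (1 - G.bartholdiEdgeMatrix b t)
      = s • (1 : Matrix G.Dart G.Dart R) - P * G.dartStartMatrix R := by
    have : 1 - G.bartholdiEdgeMatrix b t
        = (1 + (b * t) • J) - t • (G.dartEndMatrix R * G.dartStartMatrix R) := by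
      rw [bartholdiEdgeMatrix, smul_sub, smul_smul, mul_comm t b]
      abel
    rw [this, mul_sub, one_sub_mul_one_add_dartSymmMatrix, hs2, hP, Matrix.smul_mul,
      Matrix.mul_smul, Matrix.sub_mul, Matrix.sub_mul, Matrix.one_mul, Matrix.smul_mul,
      Matrix.smul_mul, Matrix.mul_assoc]
  have h2 : s • (1 : Matrix V V R) - G.dartStartMatrix R * P = G.bartholdiVertexMatrix b t := by
    rw [hP, Matrix.mul_smul, Matrix.mul_sub, Matrix.mul_smul, dartStartMatrix_mul_dartEndMatrix,
      dartStartMatrix_mul_dartSymmMatrix_mul_dartEndMatrix, bartholdiVertexMatrix, ← hsdef]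
    ext v w
    simp only [Matrix.sub_apply, Matrix.smul_apply, Matrix.add_apply, Matrix.diagonal_apply,
      Matrix.one_apply, smul_eq_mul]
    split_ifs <;> ring
  have h3 := congrArg Matrix.det h1
  rw [Matrix.det_mul, ← det_one_add_smul_dartSymmMatrix_eq, det_one_add_smul_dartSymmMatrix,
    hs2] at h3
  have h4 := smul_one_sub_mul_comm_det s P (G.dartStartMatrix R)
  rw [h2, ← h3, dart_card_eq_twice_card_edges, two_mul, pow_add] at h4
  refine mul_left_cancel₀ (pow_ne_zero G.edgeFinset.card hs) ?_
  linear_combination h4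

omit [DecidableRel G.Adj] in
theorem map_bartholdiEdgeMatrix {S : Type*} [CommRing S] (φ : R →+* S) (b t : R) :
    (G.bartholdiEdgeMatrix b t).map φ = G.bartholdiEdgeMatrix (φ b) (φ t) := by
  rw [bartholdiEdgeMatrix, bartholdiEdgeMatrix, ← G.map_dartEndMatrix φ,
    ← G.map_dartStartMatrix φ, ← G.map_dartSymmMatrix φ, ← Matrix.map_mul]
  ext
  simp [-Matrix.map_mul]

theorem map_bartholdiVertexMatrix {S : Type*} [CommRing S] (φ : R →+* S) (b t : R) :
    (G.bartholdiVertexMatrix b t).map φ = G.bartholdiVertexMatrix (φ b) (φ t) := by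
  ext v w
  by_cases h : v = w <;> simp [bartholdiVertexMatrix, h, apply_ite φ]

/-- Bass' determinant formula for the Bartholdi zeta function. -/
theorem det_one_sub_bartholdiEdgeMatrix {K : Type*} [Field K] (b t : K)
    (hs : 1 - b ^ 2 * t ^ 2 = 0 → Fintype.card V ≤ G.edgeFinset.card) :
    (1 - G.bartholdiEdgeMatrix b t).det
      = (1 - b ^ 2 * t ^ 2) ^ ((G.edgeFinset.card : ℤ) - Fintype.card V)
        * (G.bartholdiVertexMatrix b t).det := by
  by_cases h0 : 1 - b ^ 2 * t ^ 2 = 0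
  · obtain ⟨c, hc⟩ := Nat.exists_eq_add_of_le (hs h0)
    -- When `s` vanishes at `t`, nothing can be cancelled in `K`. With `t` replaced by an
    -- indeterminate, `s` is a nonzero polynomial; its common power is cancelled there before
    -- evaluating at `t`.
    have hX : (1 : K[X]) - Polynomial.C b ^ 2 * Polynomial.X ^ 2 ≠ 0 := by
      intro h
      have := congrArg (Polynomial.eval 0) h
      simp at this
    have h1 := G.pow_mul_det_one_sub_bartholdiEdgeMatrix hX
    rw [hc, pow_add, mul_assoc] at h1
    have h2 := congrArg (Polynomial.evalRingHom t) (mul_left_cancel₀ (pow_ne_zero _ hX) h1)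
    rw [map_mul, RingHom.map_det, RingHom.map_det, map_sub, map_one, RingHom.mapMatrix_apply,
      RingHom.mapMatrix_apply, map_bartholdiEdgeMatrix, map_bartholdiVertexMatrix] at h2
    have hz : (G.edgeFinset.card : ℤ) - Fintype.card V = (c : ℕ) := by rw [hc]; push_cast; ring
    rw [hz, zpow_natCast]
    simpa using h2
  · rw [zpow_sub₀ h0, zpow_natCast, zpow_natCast, div_mul_eq_mul_div, eq_div_iff (pow_ne_zero _ h0),
      ← G.pow_mul_det_one_sub_bartholdiEdgeMatrix h0, mul_comm]

end DartMatrices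

end SimpleGraph

/-! ### Determinants of block diagonal matrices with constant blocks added. -/

namespace Matrix

variable {ι : Type*} [Fintype ι] [DecidableEq ι] {V : ι → Type*} [∀ i, Fintype (V i)]
  [∀ i, DecidableEq (V i)]

/-- The block matrix with diagonal blocks `M i`, to whose `(i, j)` block the constant `C i j` is
added. -/
def joinMatrix {R : Type*} [CommRing R] (M : ∀ i, Matrix (V i) (V i) R) (C : Matrix ι ι R) :
    Matrix (Σ i, V i) (Σ i, V i) R :=
  blockDiagonal' M + of fun p q => C p.1 q.1

theorem det_blockDiagonal'_eq_prod {R : Type*} [CommRing R] (M : ∀ i, Matrix (V i) (V i) R) :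
    (blockDiagonal' M).det = ∏ i, (M i).det := by
  set e := Fintype.equivFin ι
  have ht : BlockTriangular (blockDiagonal' M) fun p => e p.1 := by
    rintro ⟨i, v⟩ ⟨j, w⟩ h
    refine blockDiagonal'_apply_ne M v w ?_
    rintro rfl
    exact lt_irrefl _ h
  rw [ht.det_fintype, ← e.prod_comp]
  refine Finset.prod_congr rfl fun i _ => ?_
  let f : V i ≃ {p : Σ i, V i // e p.1 = e i} := Equiv.ofBijective (fun v => ⟨⟨i, v⟩, rfl⟩)
    ⟨fun v w h => by simpa using h, by
      rintro ⟨⟨j, w⟩, h⟩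
      obtain rfl : j = i := e.injective h
      exact ⟨w, rfl⟩⟩
  rw [← det_submatrix_equiv_self f]
  congr 1
  ext v w
  exact blockDiagonal'_apply_eq M i v w

/-- Constant row sums make the span of the indicator vectors of the parts invariant under the block
diagonal matrix, which can therefore be factored out on the left without being inverted. -/
theorem det_joinMatrix_quotient {K : Type*} [Field K] (M : ∀ i, Matrix (V i) (V i) K)
    (C : Matrix ι ι K) (r : ι → K) (hr : ∀ i, r i ≠ 0) (hM : ∀ i v, ∑ w, M i v w = r i) :
    (joinMatrix M C).det
      = (diagonal r + C * diagonal fun i => (Fintype.card (V i) : K)).det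
        * ∏ i, ((M i).det / r i) := by
  set P : Matrix (Σ i, V i) ι K := of fun p i => if p.1 = i then 1 else 0 with hP
  set P' : Matrix ι (Σ i, V i) K := of fun i p => if p.1 = i then 1 else 0 with hP'
  set Q : Matrix ι ι K := diagonal (fun i => (r i)⁻¹) * C with hQ
  have hMP : blockDiagonal' M * P = P * diagonal r := by
    ext ⟨i, v⟩ j
    rw [mul_diagonal, mul_apply, Fintype.sum_sigma, Finset.sum_eq_single i]
    · by_cases h : i = j
      · subst h
        simp [hP, hM]
      · simp [hP, h]
    · intro k _ hk
      simp [blockDiagonal'_apply, hk.symm]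
    · simp
  have hC : (of fun p q => C p.1 q.1 : Matrix (Σ i, V i) (Σ i, V i) K) = P * C * P' := by
    ext p q
    simp [mul_apply, hP, hP']
  have hr1 : diagonal r * diagonal (fun i => (r i)⁻¹) = 1 := by
    rw [diagonal_mul_diagonal, ← diagonal_one]
    congr 1
    funext i
    exact mul_inv_cancel₀ (hr i)
  have h1 : joinMatrix M C = blockDiagonal' M * (1 + P * (Q * P')) := by
    rw [joinMatrix, hC, Matrix.mul_add, Matrix.mul_one, ← Matrix.mul_assoc, hMP, hQ,
      Matrix.mul_assoc P (diagonal r), ← Matrix.mul_assoc (diagonal r),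
      ← Matrix.mul_assoc (diagonal r), hr1, Matrix.one_mul, Matrix.mul_assoc]
  have h2 : P' * P = diagonal fun i => (Fintype.card (V i) : K) := by
    ext i j
    rw [mul_apply, Fintype.sum_sigma, diagonal_apply]
    simp only [hP, hP', of_apply]
    rw [Finset.sum_eq_single i (fun k _ hk => by simp [hk]) (by simp)]
    simp
  have h3 : diagonal r * (1 + Q * P' * P)
      = diagonal r + C * diagonal fun i => (Fintype.card (V i) : K) := by
    rw [Matrix.mul_assoc, h2, Matrix.mul_add, Matrix.mul_one, hQ, Matrix.mul_assoc,
      ← Matrix.mul_assoc (diagonal r), hr1, Matrix.one_mul]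
  rw [h1, det_mul, det_one_add_mul_comm, det_blockDiagonal'_eq_prod, ← h3, det_mul, det_diagonal,
    Finset.prod_div_distrib]
  have : ∏ i, r i ≠ 0 := Finset.prod_ne_zero_iff.2 fun i _ => hr i
  field_simp

theorem det_diagonal_add_mul_diagonal {K : Type*} [Field K] (C : Matrix ι ι K) (r n : ι → K)
    (hn : ∀ i, n i ≠ 0) :
    (diagonal r + C * diagonal n).det = (C + diagonal fun i => 1 / n i * r i).det * ∏ i, n i := by
  rw [← det_diagonal, ← det_mul, Matrix.add_mul, diagonal_mul_diagonal, add_comm]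
  congr 3
  funext i
  field_simp [hn i]

theorem det_joinMatrix {K : Type*} [Field K] (M : ∀ i, Matrix (V i) (V i) K)
    (C : Matrix ι ι K) (r : ι → K) (hr : ∀ i, r i ≠ 0) (hM : ∀ i v, ∑ w, M i v w = r i)
    (hn : ∀ i, (Fintype.card (V i) : K) ≠ 0) :
    (joinMatrix M C).det
      = (C + diagonal fun i => 1 / (Fintype.card (V i) : K) * r i).det
        * ∏ i, ((Fintype.card (V i) : K) * (M i).det / r i) := by
  rw [det_joinMatrix_quotient M C r hr hM, det_diagonal_add_mul_diagonal C r _ hn, mul_assoc,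
    ← Finset.prod_mul_distrib]
  simp only [mul_div_assoc]

end Matrix

/-! ### Adjacency, degrees and quotient of the generalized join. -/

section Join

variable {ι : Type*} [Fintype ι] [DecidableEq ι] {V : ι → Type*} [∀ i, Fintype (V i)]
  [∀ i, DecidableEq (V i)] (H : SimpleGraph ι) [DecidableRel H.Adj]
  (X : ∀ i, SimpleGraph (V i)) [∀ i, DecidableRel (X i).Adj]
  [DecidableRel (generalizedJoin H X).Adj]

omit [Fintype ι] [DecidableEq ι] [∀ i, Fintype (V i)] [∀ i, DecidableEq (V i)]
  [DecidableRel H.Adj] [∀ i, DecidableRel (X i).Adj] [DecidableRel (generalizedJoin H X).Adj] in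
theorem generalizedJoin_adj_of_ne {i j : ι} (h : i ≠ j) (v : V i) (w : V j) :
    (generalizedJoin H X).Adj ⟨i, v⟩ ⟨j, w⟩ ↔ H.Adj i j := by
  constructor
  · rintro (h' | ⟨h', _⟩)
    · exact h'
    · exact absurd h' h
  · exact Or.inl

omit [Fintype ι] [DecidableEq ι] [∀ i, Fintype (V i)] [∀ i, DecidableEq (V i)]
  [DecidableRel H.Adj] [∀ i, DecidableRel (X i).Adj] [DecidableRel (generalizedJoin H X).Adj] in
theorem generalizedJoin_adj_same {i : ι} (v w : V i) :
    (generalizedJoin H X).Adj ⟨i, v⟩ ⟨i, w⟩ ↔ (X i).Adj v w := by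
  constructor
  · rintro (h' | ⟨_, h'⟩)
    · exact absurd h' H.irrefl
    · exact h'
  · exact fun h => Or.inr ⟨rfl, h⟩

omit [Fintype ι] [∀ i, Fintype (V i)] [∀ i, DecidableEq (V i)] in
theorem adjMatrix_generalizedJoin (R : Type*) [CommRing R] :
    (generalizedJoin H X).adjMatrix R
      = Matrix.joinMatrix (fun i => (X i).adjMatrix R) (H.adjMatrix R) := by
  ext ⟨i, v⟩ ⟨j, w⟩
  rw [Matrix.joinMatrix, Matrix.add_apply, Matrix.blockDiagonal'_apply]
  by_cases h : i = j
  · subst h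
    simp [generalizedJoin_adj_same]
  · simp [generalizedJoin_adj_of_ne H X h, h]

omit [Fintype ι] [∀ i, Fintype (V i)] in
theorem smul_adjMatrix_generalizedJoin_add_diagonal {R : Type*} [CommRing R] (a : R) (d : ι → R) :
    a • (generalizedJoin H X).adjMatrix R + Matrix.diagonal (fun v : Σ i, V i => d v.1)
      = Matrix.joinMatrix (fun i => a • (X i).adjMatrix R + d i • (1 : Matrix (V i) (V i) R))
          (a • H.adjMatrix R) := by
  rw [adjMatrix_generalizedJoin]
  ext ⟨i, v⟩ ⟨j, w⟩
  simp only [Matrix.joinMatrix, Matrix.add_apply, Matrix.blockDiagonal'_apply, Matrix.smul_apply,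
    Matrix.of_apply, Matrix.diagonal_apply, smul_eq_mul]
  by_cases h : i = j
  · subst h
    simp [Matrix.one_apply]
  · simp [h]

variable {X} {k : ι → ℕ}

omit [Fintype ι] [DecidableEq ι] in
theorem sum_smul_adjMatrix_add_smul_one (hk : ∀ i, (X i).IsRegularOfDegree (k i)) {R : Type*}
    [CommRing R] (a : R) (d : ι → R) (i : ι) (v : V i) :
    ∑ w, (a • (X i).adjMatrix R + d i • (1 : Matrix (V i) (V i) R)) v w = a * k i + d i := by
  simp only [Matrix.add_apply, Matrix.smul_apply, smul_eq_mul, Finset.sum_add_distrib,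
    ← Finset.mul_sum, Matrix.one_apply, SimpleGraph.adjMatrix_apply]
  have h := hk i v
  rw [← SimpleGraph.card_neighborFinset_eq_degree, SimpleGraph.neighborFinset_eq_filter] at h
  simp [h]

omit [∀ i, DecidableEq (V i)] in
theorem cellDegree_generalizedJoin (hk : ∀ i, (X i).IsRegularOfDegree (k i)) (p : Σ i, V i)
    (j : ι) :
    cellDegree (generalizedJoin H X) Sigma.fst p j
      = (if p.1 = j then k j else 0) + H.adjMatrix ℕ p.1 j * Fintype.card (V j) := by
  obtain ⟨i, v⟩ := p
  rw [cellDegree, Finset.card_filter, Fintype.sum_sigma, Finset.sum_eq_single j]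
  · by_cases h : i = j
    · subst h
      have h := hk i v
      rw [← SimpleGraph.card_neighborFinset_eq_degree, SimpleGraph.neighborFinset_eq_filter] at h
      simp [generalizedJoin_adj_same, h]
    · simp [generalizedJoin_adj_of_ne H X h, h, SimpleGraph.adjMatrix_apply]
  · intro l _ hl
    simp [hl]
  · simp

omit [∀ i, DecidableEq (V i)] in
theorem degree_generalizedJoin (hk : ∀ i, (X i).IsRegularOfDegree (k i)) (i : ι) (v : V i) :
    (generalizedJoin H X).degree ⟨i, v⟩ = joinDegree V H k i := by
  have h : (generalizedJoin H X).degree ⟨i, v⟩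
      = ∑ j, cellDegree (generalizedJoin H X) Sigma.fst ⟨i, v⟩ j := by
    simp only [cellDegree]
    rw [← SimpleGraph.card_neighborFinset_eq_degree, SimpleGraph.neighborFinset_eq_filter,
      Finset.card_eq_sum_card_fiberwise (f := Sigma.fst) (t := Finset.univ) (by simp)]
    simp [Finset.filter_filter]
  simp only [h, cellDegree_generalizedJoin H hk, Finset.sum_add_distrib, joinDegree]
  rw [Finset.sum_erase _ (by simp)]
  simp

variable [∀ i, Nonempty (V i)]

omit [∀ i, DecidableEq (V i)] in
theorem smul_quotientAdjMatrix_add_diagonal (hk : ∀ i, (X i).IsRegularOfDegree (k i)) {R : Type*}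
    [CommRing R] (a : R) (d : ι → R) :
    a • quotientAdjMatrix R (generalizedJoin H X) Sigma.fst Sigma.fst_surjective
        + Matrix.diagonal d
      = Matrix.diagonal (fun i => a * k i + d i)
        + a • H.adjMatrix R * Matrix.diagonal fun i => (Fintype.card (V i) : R) := by
  ext i j
  rw [Matrix.add_apply, Matrix.add_apply, Matrix.mul_diagonal, Matrix.smul_apply, Matrix.smul_apply,
    quotientAdjMatrix, Matrix.of_apply, cellDegree_generalizedJoin H hk, 
    -- The degree into a cell depends only on the part of the vertex, so the chosen representative
    -- disappears.
    Function.surjInv_eq Sigma.fst_surjective,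
    Matrix.diagonal_apply, Matrix.diagonal_apply]
  by_cases h : i = j
  · subst h
    simp
  · simp [h, SimpleGraph.adjMatrix_apply]

/-- The field is general because both `RatFunc ℂ` (characteristic polynomials) and `ℂ` (zeta
function) are needed; characteristic zero keeps the part sizes invertible. -/
theorem det_generalizedJoin (hk : ∀ i, (X i).IsRegularOfDegree (k i)) {K : Type*} [Field K]
    [CharZero K] (a : K) (d : ι → K) (hr : ∀ i, a * k i + d i ≠ 0) :
    (a • (generalizedJoin H X).adjMatrix K + Matrix.diagonal (fun v : Σ i, V i => d v.1)).det
        = (a • quotientAdjMatrix K (generalizedJoin H X) Sigma.fst Sigma.fst_surjective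
            + Matrix.diagonal d).det
          * ∏ i, ((a • (X i).adjMatrix K + d i • (1 : Matrix (V i) (V i) K)).det / (a * k i + d i)) ∧
      (a • (generalizedJoin H X).adjMatrix K + Matrix.diagonal (fun v : Σ i, V i => d v.1)).det
        = (a • H.adjMatrix K
            + Matrix.diagonal fun i => 1 / (Fintype.card (V i) : K) * (a * k i + d i)).det
          * ∏ i, ((Fintype.card (V i) : K)
            * (a • (X i).adjMatrix K + d i • (1 : Matrix (V i) (V i) K)).det / (a * k i + d i)) := by
  rw [smul_adjMatrix_generalizedJoin_add_diagonal, smul_quotientAdjMatrix_add_diagonal H hk]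
  exact ⟨Matrix.det_joinMatrix_quotient _ _ _ hr (sum_smul_adjMatrix_add_smul_one hk a d),
    Matrix.det_joinMatrix _ _ _ hr (sum_smul_adjMatrix_add_smul_one hk a d)
      fun i => Nat.cast_ne_zero.2 Fintype.card_ne_zero⟩

end Join

/-! ### Characteristic polynomials as determinants over the rational functions. -/

section CharacteristicPolynomial

theorem Matrix.algebraMap_ratFunc_charpoly {n K : Type*} [Fintype n] [DecidableEq n] [Field K]
    (M : Matrix n n K) :
    algebraMap K[X] (RatFunc K) M.charpoly
      = (Matrix.diagonal (fun _ => RatFunc.X) - M.map RatFunc.C).det := by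
  rw [Matrix.charpoly, RingHom.map_det]
  congr 1
  ext i j
  by_cases h : i = j
  · subst h
    simp [Matrix.charmatrix]
  · simp [Matrix.charmatrix, h]

variable {ι : Type*} [Fintype ι] [DecidableEq ι] {V : ι → Type*} [∀ i, Fintype (V i)]
  [∀ i, DecidableEq (V i)] [∀ i, Nonempty (V i)] (H : SimpleGraph ι) [DecidableRel H.Adj]
  {X : ∀ i, SimpleGraph (V i)} [∀ i, DecidableRel (X i).Adj]
  [DecidableRel (generalizedJoin H X).Adj] {k : ι → ℕ}

theorem charpoly_generalizedJoin (hk : ∀ i, (X i).IsRegularOfDegree (k i)) (α : ℂ) (d : ι → ℂ) :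
    algebraMap ℂ[X] (RatFunc ℂ) (α • (generalizedJoin H X).adjMatrix ℂ +
          Matrix.diagonal (fun v : Σ i, V i => d v.1)).charpoly =
        algebraMap ℂ[X] (RatFunc ℂ)
          (α • quotientAdjMatrix ℂ (generalizedJoin H X) Sigma.fst Sigma.fst_surjective +
            Matrix.diagonal d).charpoly *
        ∏ i, (algebraMap ℂ[X] (RatFunc ℂ)
            (α • (X i).adjMatrix ℂ + d i • (1 : Matrix (V i) (V i) ℂ)).charpoly /
          (RatFunc.X - RatFunc.C (α * (k i : ℂ)) - RatFunc.C (d i))) ∧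
      algebraMap ℂ[X] (RatFunc ℂ) (α • (generalizedJoin H X).adjMatrix ℂ +
          Matrix.diagonal (fun v : Σ i, V i => d v.1)).charpoly =
        (-(RatFunc.C α • H.adjMatrix (RatFunc ℂ)) +
          Matrix.diagonal (fun i => 1 / (Fintype.card (V i) : RatFunc ℂ) *
            (RatFunc.X - RatFunc.C (α * (k i : ℂ)) - RatFunc.C (d i)))).det *
        ∏ i, ((Fintype.card (V i) : RatFunc ℂ) * algebraMap ℂ[X] (RatFunc ℂ)
            (α • (X i).adjMatrix ℂ + d i • (1 : Matrix (V i) (V i) ℂ)).charpoly /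
          (RatFunc.X - RatFunc.C (α * (k i : ℂ)) - RatFunc.C (d i))) := by
  have hden : ∀ i, -RatFunc.C α * (k i : RatFunc ℂ) + (RatFunc.X - RatFunc.C (d i))
      = RatFunc.X - RatFunc.C (α * (k i : ℂ)) - RatFunc.C (d i) := by
    intro i
    rw [map_mul, map_natCast]
    ring
  have hne : ∀ i, -RatFunc.C α * (k i : RatFunc ℂ) + (RatFunc.X - RatFunc.C (d i)) ≠ 0 := by
    intro i h
    have h1 : algebraMap ℂ[X] (RatFunc ℂ)
        (Polynomial.X - Polynomial.C (α * (k i : ℂ) + d i)) = 0 := by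
      rw [← h, hden, map_sub, RatFunc.algebraMap_X, RatFunc.algebraMap_C, map_add]
      ring
    exact Polynomial.X_sub_C_ne_zero _
      ((map_eq_zero_iff _ (RatFunc.algebraMap_injective ℂ)).1 h1)
  -- The matrix `x - (α A + D)` is again a multiple of `A` plus a diagonal constant on parts.
  have key := det_generalizedJoin H hk (-RatFunc.C α) (fun i => RatFunc.X - RatFunc.C (d i)) hne
  have e1 : algebraMap ℂ[X] (RatFunc ℂ) (α • (generalizedJoin H X).adjMatrix ℂ +
          Matrix.diagonal (fun v : Σ i, V i => d v.1)).charpoly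
      = (-RatFunc.C α • (generalizedJoin H X).adjMatrix (RatFunc ℂ)
        + Matrix.diagonal (fun v : Σ i, V i => RatFunc.X - RatFunc.C (d v.1))).det := by
    rw [Matrix.algebraMap_ratFunc_charpoly]
    congr 1
    ext p q
    by_cases h : p = q
    · simp [h]
    · simp [h, apply_ite RatFunc.C]
  have e2 : algebraMap ℂ[X] (RatFunc ℂ)
          (α • quotientAdjMatrix ℂ (generalizedJoin H X) Sigma.fst Sigma.fst_surjective +
            Matrix.diagonal d).charpoly
      = (-RatFunc.C α • quotientAdjMatrix (RatFunc ℂ) (generalizedJoin H X) Sigma.fst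
            Sigma.fst_surjective
        + Matrix.diagonal (fun i => RatFunc.X - RatFunc.C (d i))).det := by
    rw [Matrix.algebraMap_ratFunc_charpoly]
    congr 1
    ext p q
    by_cases h : p = q
    · simp [h, quotientAdjMatrix]
      ring
    · simp [h, quotientAdjMatrix]
  have e3 : ∀ i, algebraMap ℂ[X] (RatFunc ℂ)
            (α • (X i).adjMatrix ℂ + d i • (1 : Matrix (V i) (V i) ℂ)).charpoly
      = (-RatFunc.C α • (X i).adjMatrix (RatFunc ℂ)
        + (RatFunc.X - RatFunc.C (d i)) • (1 : Matrix (V i) (V i) (RatFunc ℂ))).det := by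
    intro i
    rw [Matrix.algebraMap_ratFunc_charpoly]
    congr 1
    ext p q
    by_cases h : p = q
    · simp [h]
    · simp [h, apply_ite RatFunc.C]
  simp only [e1, e2, e3]
  simpa only [hden, neg_smul] using key

end CharacteristicPolynomial

/-! ### The Euler product as a determinant on oriented edges. -/

section Zeta

theorem Cycle.chain_coe_iff_forall₂ {α : Type*} {r : α → α → Prop} (l : List α) :
    Cycle.Chain r (l : Cycle α) ↔ List.Forall₂ r l (l.rotate 1) := by
  cases l with
  | nil => simp
  | cons a l =>
    rw [Cycle.chain_coe_cons, ← List.cons_append, List.isChain_cons_append_singleton_iff_forall₂]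
    simp

/-- If some factor `1 - f b` vanishes, then `1 / 0 = 0` makes both products `0`, which matches the
convention for the inverse zeta value. Otherwise absolute convergence keeps the product nonzero, so
it can be inverted factorwise. -/
theorem tprod_one_div_inv {β : Type*} {f : β → ℂ} (hf : Summable fun b => ‖f b‖) :
    (∏' b, 1 / (1 - f b))⁻¹ = ∏' b, (1 - f b) := by
  by_cases h : ∃ b, 1 - f b = 0
  · have h' : ∃ b, 1 / (1 - f b) = 0 := h.imp fun b hb => by simp [hb]
    rw [tprod_of_exists_eq_zero h, tprod_of_exists_eq_zero h', inv_zero]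
  · push Not at h
    have hs : Summable fun b => ‖-f b‖ := by simpa using hf
    have hm := (multipliable_one_add_of_summable hs).hasProd
    have hne := tprod_one_add_ne_zero_of_summable (f := fun b => -f b)
      (fun b => by simpa [← sub_eq_add_neg] using h b) hs
    simp only [← sub_eq_add_neg] at hm hne
    have := hm.inv₀ hne
    simp only [one_div]
    rw [this.tprod_eq, inv_inv]

namespace SimpleGraph

variable {V : Type*} [Fintype V] [DecidableEq V] (G : SimpleGraph V)

/-- A backtracking step is always composable and its entry is `t (1 - (1 - u)) = t u`, so weights of
closed paths count bumps. -/
theorem bartholdiEdgeMatrix_apply (u t : ℂ) (e f : G.Dart) :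
    G.bartholdiEdgeMatrix (1 - u) t e f
      = if e.snd = f.fst then t * u ^ (if f = e.symm then 1 else 0) else 0 := by
  rw [bartholdiEdgeMatrix, Matrix.smul_apply, Matrix.sub_apply, Matrix.smul_apply,
    dartEndMatrix_mul_dartStartMatrix_apply, dartSymmMatrix, Matrix.of_apply]
  by_cases h : f = e.symm
  · subst h
    simp
  · simp [h]

theorem wordWeight_bartholdiEdgeMatrix_of_forall₂ (u t : ℂ) (l : List G.Dart)
    (h : List.Forall₂ (fun e f : G.Dart => e.snd = f.fst) l (l.rotate 1)) :
    Matrix.wordWeight (G.bartholdiEdgeMatrix (1 - u) t) l = u ^ listBumpCount l * t ^ l.length := by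
  rw [Matrix.wordWeight, listBumpCount]
  generalize l.rotate 1 = m at h ⊢
  induction h with
  | nil => simp
  | @cons e f l l' hef _ ih =>
    rw [List.zipWith_cons_cons, List.zipWith_cons_cons, List.prod_cons, List.sum_cons, ih,
      bartholdiEdgeMatrix_apply, if_pos hef, pow_add, List.length_cons, pow_succ]
    by_cases h : f = e.symm
    · simp [h]; ring
    · simp [h]; ring

theorem wordWeight_bartholdiEdgeMatrix_of_not_forall₂ (u t : ℂ) (l : List G.Dart)
    (h : ¬ List.Forall₂ (fun e f : G.Dart => e.snd = f.fst) l (l.rotate 1)) :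
    Matrix.wordWeight (G.bartholdiEdgeMatrix (1 - u) t) l = 0 := by
  have key : ∀ l l' : List G.Dart, l.length = l'.length →
      ¬ List.Forall₂ (fun e f : G.Dart => e.snd = f.fst) l l' →
      (List.zipWith (fun e f => G.bartholdiEdgeMatrix (1 - u) t e f) l l').prod = 0 := by
    intro l
    induction l with
    | nil =>
      rintro (_ | ⟨f, l'⟩) hl h
      · exact absurd List.Forall₂.nil h
      · simp at hl
    | cons e l ih =>
      rintro (_ | ⟨f, l'⟩) hl h
      · simp at hl
      · rw [List.zipWith_cons_cons, List.prod_cons, bartholdiEdgeMatrix_apply]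
        by_cases hef : e.snd = f.fst
        · rw [ih l' (by simpa using hl) fun h' => h (List.Forall₂.cons hef h'), mul_zero]
        · rw [if_neg hef, zero_mul]
  exact key _ _ (by simp) h

theorem cycleWeight_bartholdiEdgeMatrix_of_chain (u t : ℂ) {C : Cycle G.Dart}
    (h : C.Chain fun e f => e.snd = f.fst) :
    Matrix.cycleWeight (G.bartholdiEdgeMatrix (1 - u) t) C
      = u ^ cyclicBumpCount C * t ^ C.length := by
  induction C using Quotient.inductionOn' with
  | h l =>
    exact G.wordWeight_bartholdiEdgeMatrix_of_forall₂ u t l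
      ((Cycle.chain_coe_iff_forall₂ l).1 h)

theorem cycleWeight_bartholdiEdgeMatrix_of_not_chain (u t : ℂ) {C : Cycle G.Dart}
    (h : ¬ C.Chain fun e f => e.snd = f.fst) :
    Matrix.cycleWeight (G.bartholdiEdgeMatrix (1 - u) t) C = 0 := by
  induction C using Quotient.inductionOn' with
  | h l =>
    exact G.wordWeight_bartholdiEdgeMatrix_of_not_forall₂ u t l
      fun h' => h ((Cycle.chain_coe_iff_forall₂ l).2 h')

/-- A prime cycle of a graph as a primitive cyclic word in the oriented edges. -/
def PrimeCycle.toPrimitive {G : SimpleGraph V} (C : PrimeCycle G) :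
    {C : Cycle G.Dart // C.IsPrimitive} :=
  ⟨C.1, C.2.1, C.2.2.2⟩

omit [Fintype V] [DecidableEq V] in
theorem toPrimitive_injective :
    Function.Injective (PrimeCycle.toPrimitive : PrimeCycle G → _) := fun _ _ h =>
  Subtype.ext (congrArg (fun D : {C : Cycle G.Dart // C.IsPrimitive} => D.1) h)

theorem cycleWeight_toPrimitive (u t : ℂ) (C : PrimeCycle G) :
    Matrix.cycleWeight (G.bartholdiEdgeMatrix (1 - u) t) (PrimeCycle.toPrimitive C).1
      = bartholdiTerm G u t C :=
  G.cycleWeight_bartholdiEdgeMatrix_of_chain u t C.2.2.1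

theorem cycleWeight_eq_zero_of_notMem_range (u t : ℂ)
    {D : {C : Cycle G.Dart // C.IsPrimitive}}
    (hD : D ∉ Set.range (PrimeCycle.toPrimitive : PrimeCycle G → _)) :
    Matrix.cycleWeight (G.bartholdiEdgeMatrix (1 - u) t) D.1 = 0 :=
  G.cycleWeight_bartholdiEdgeMatrix_of_not_chain u t fun h =>
    hD ⟨⟨D.1, D.2.1, h, D.2.2⟩, rfl⟩

/-- Primitive cyclic words that are not closed paths have weight `0`; they affect neither the sum
nor, later, the product. -/
theorem bartholdiConverges_iff (u t : ℂ) :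
    BartholdiConverges G u t ↔ Summable fun D : {C : Cycle G.Dart // C.IsPrimitive} =>
      ‖Matrix.cycleWeight (G.bartholdiEdgeMatrix (1 - u) t) D.1‖ := by
  rw [BartholdiConverges, ← G.toPrimitive_injective.summable_iff]
  · simp only [Function.comp_def, cycleWeight_toPrimitive]
  · intro D hD
    rw [cycleWeight_eq_zero_of_notMem_range G u t hD, norm_zero]

variable [DecidableRel G.Adj]

theorem inv_bartholdiZeta {u t : ℂ} (h : BartholdiConverges G u t) :
    (bartholdiZeta G u t)⁻¹ = (1 - G.bartholdiEdgeMatrix (1 - u) t).det := by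
  rw [bartholdiZeta, tprod_one_div_inv h,
    ← Matrix.tprod_one_sub_cycleWeight ((G.bartholdiConverges_iff u t).1 h),
    ← G.toPrimitive_injective.tprod_eq]
  · simp only [cycleWeight_toPrimitive]
  · intro D hD
    by_contra hD'
    rw [Function.mem_mulSupport, cycleWeight_eq_zero_of_notMem_range G u t hD', sub_zero] at hD
    exact hD rfl

theorem eventually_bartholdiConverges (u : ℂ) : ∀ᶠ t in 𝓝 (0 : ℂ), BartholdiConverges G u t := by
  obtain ⟨M, hM, hW⟩ := Matrix.exists_norm_apply_le (G.bartholdiEdgeMatrix (1 - u) (1 : ℂ))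
  have h : ∀ᶠ t in 𝓝 (0 : ℂ), Fintype.card G.Dart * (‖t‖ * M) < 1 :=
    (Continuous.tendsto' (by fun_prop) 0 0 (by simp)).eventually_lt_const one_pos
  filter_upwards [h] with t ht
  refine (G.bartholdiConverges_iff u t).2
    (Matrix.summable_norm_cycleWeight (r := ‖t‖ * M) (by positivity) (fun e f => ?_) ht)
  rw [← mul_le_mul_iff_of_pos_left (zero_lt_one' ℝ)]
  have : G.bartholdiEdgeMatrix (1 - u) t e f = t * G.bartholdiEdgeMatrix (1 - u) (1 : ℂ) e f := by
    simp [bartholdiEdgeMatrix]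
  rw [one_mul, one_mul, this, norm_mul]
  exact mul_le_mul_of_nonneg_left (hW e f) (norm_nonneg t)

end SimpleGraph

end Zeta

theorem corollary6p1 {ι : Type*} [Fintype ι] [DecidableEq ι]
    {V : ι → Type*} [∀ i, Fintype (V i)] [∀ i, DecidableEq (V i)] [∀ i, Nonempty (V i)]
    (H : SimpleGraph ι) [DecidableRel H.Adj]
    (X : ∀ i, SimpleGraph (V i)) [∀ i, DecidableRel (X i).Adj]
    [DecidableRel (generalizedJoin H X).Adj]
    (k : ι → ℕ) (hk : ∀ i, (X i).IsRegularOfDegree (k i)) :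
    -- the partition into the vertex sets of the `X i` is equitable
    IsEquitablePartition (generalizedJoin H X) Sigma.fst ∧
    -- general formulas, as identities of rational functions of `x`
    (∀ (α : ℂ) (d : ι → ℂ),
      algebraMap ℂ[X] (RatFunc ℂ) (α • (generalizedJoin H X).adjMatrix ℂ +
          Matrix.diagonal (fun v : Σ i, V i => d v.1)).charpoly =
        algebraMap ℂ[X] (RatFunc ℂ)
          (α • quotientAdjMatrix ℂ (generalizedJoin H X) Sigma.fst Sigma.fst_surjective +
            Matrix.diagonal d).charpoly *
        ∏ i, (algebraMap ℂ[X] (RatFunc ℂ)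
            (α • (X i).adjMatrix ℂ + d i • (1 : Matrix (V i) (V i) ℂ)).charpoly /
          (RatFunc.X - RatFunc.C (α * (k i : ℂ)) - RatFunc.C (d i))) ∧
      algebraMap ℂ[X] (RatFunc ℂ) (α • (generalizedJoin H X).adjMatrix ℂ +
          Matrix.diagonal (fun v : Σ i, V i => d v.1)).charpoly =
        (-(RatFunc.C α • H.adjMatrix (RatFunc ℂ)) +
          Matrix.diagonal (fun i => 1 / (Fintype.card (V i) : RatFunc ℂ) *
            (RatFunc.X - RatFunc.C (α * (k i : ℂ)) - RatFunc.C (d i)))).det *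
        ∏ i, ((Fintype.card (V i) : RatFunc ℂ) * algebraMap ℂ[X] (RatFunc ℂ)
            (α • (X i).adjMatrix ℂ + d i • (1 : Matrix (V i) (V i) ℂ)).charpoly /
          (RatFunc.X - RatFunc.C (α * (k i : ℂ)) - RatFunc.C (d i)))) ∧
    -- (a) the characteristic polynomial of the adjacency matrix
    (algebraMap ℂ[X] (RatFunc ℂ) ((generalizedJoin H X).adjMatrix ℂ).charpoly =
        algebraMap ℂ[X] (RatFunc ℂ)
          (quotientAdjMatrix ℂ (generalizedJoin H X) Sigma.fst Sigma.fst_surjective).charpoly *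
        ∏ i, (algebraMap ℂ[X] (RatFunc ℂ) ((X i).adjMatrix ℂ).charpoly /
          (RatFunc.X - (k i : RatFunc ℂ))) ∧
      algebraMap ℂ[X] (RatFunc ℂ) ((generalizedJoin H X).adjMatrix ℂ).charpoly =
        (-H.adjMatrix (RatFunc ℂ) +
          Matrix.diagonal (fun i => 1 / (Fintype.card (V i) : RatFunc ℂ) *
            (RatFunc.X - (k i : RatFunc ℂ)))).det *
        ∏ i, ((Fintype.card (V i) : RatFunc ℂ) *
            algebraMap ℂ[X] (RatFunc ℂ) ((X i).adjMatrix ℂ).charpoly /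
          (RatFunc.X - (k i : RatFunc ℂ)))) ∧
    -- (b) the Ihara-Bartholdi zeta function
    (∀ (i : ι) (v : V i), (generalizedJoin H X).degree ⟨i, v⟩ = joinDegree V H k i) ∧
    (∀ u : ℂ, ∀ᶠ t in 𝓝 (0 : ℂ), BartholdiConverges (generalizedJoin H X) u t ∧
      bartholdiS₁ u t ≠ 0 ∧ ∀ i, -t * (k i : ℂ) + joinZetaDegree V H k u t i ≠ 0) ∧
    (∀ u t : ℂ, BartholdiConverges (generalizedJoin H X) u t →
      (bartholdiS₁ u t = 0 →
        Fintype.card (Σ i, V i) ≤ (generalizedJoin H X).edgeFinset.card) →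
      (∀ i, -t * (k i : ℂ) + joinZetaDegree V H k u t i ≠ 0) →
      (bartholdiZeta (generalizedJoin H X) u t)⁻¹ =
        bartholdiS₁ u t ^ (((generalizedJoin H X).edgeFinset.card : ℤ) -
          (Fintype.card (Σ i, V i) : ℤ)) *
        (-t • quotientAdjMatrix ℂ (generalizedJoin H X) Sigma.fst Sigma.fst_surjective +
          Matrix.diagonal (joinZetaDegree V H k u t)).det *
        ∏ i, ((-t • (X i).adjMatrix ℂ +
            joinZetaDegree V H k u t i • (1 : Matrix (V i) (V i) ℂ)).det /
          (-t * (k i : ℂ) + joinZetaDegree V H k u t i)) ∧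
      (bartholdiZeta (generalizedJoin H X) u t)⁻¹ =
        bartholdiS₁ u t ^ (((generalizedJoin H X).edgeFinset.card : ℤ) -
          (Fintype.card (Σ i, V i) : ℤ)) *
        (-t • H.adjMatrix ℂ + Matrix.diagonal (fun i => 1 / (Fintype.card (V i) : ℂ) *
          (-t * (k i : ℂ) + joinZetaDegree V H k u t i))).det *
        ∏ i, ((Fintype.card (V i) : ℂ) * (-t • (X i).adjMatrix ℂ +
            joinZetaDegree V H k u t i • (1 : Matrix (V i) (V i) ℂ)).det /
          (-t * (k i : ℂ) + joinZetaDegree V H k u t i))) := by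

  have hmain := charpoly_generalizedJoin H hk
  refine ⟨?_, hmain, ?_, degree_generalizedJoin H hk, ?_, ?_⟩
  · intro p q h j
    rw [cellDegree_generalizedJoin H hk, cellDegree_generalizedJoin H hk, h]
  -- Part (a) is the case `α = 1`, `d = 0`.
  · simpa using hmain 1 0
  · intro u
    have hs : ∀ᶠ t in 𝓝 (0 : ℂ), bartholdiS₁ u t ≠ 0 := by
      refine (Continuous.tendsto' ?_ 0 1 (by simp [bartholdiS₁])).eventually_ne one_ne_zero
      unfold bartholdiS₁
      fun_prop
    have hd : ∀ᶠ t in 𝓝 (0 : ℂ), ∀ i, -t * (k i : ℂ) + joinZetaDegree V H k u t i ≠ 0 := by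
      refine Filter.eventually_all.2 fun i => ?_
      refine (Continuous.tendsto' ?_ 0 1
        (by simp [joinZetaDegree, bartholdiS₁, bartholdiS₂])).eventually_ne one_ne_zero
      unfold joinZetaDegree bartholdiS₁ bartholdiS₂
      fun_prop
    filter_upwards [(generalizedJoin H X).eventually_bartholdiConverges u, hs, hd] with t h1 h2 h3
    exact ⟨h1, h2, h3⟩
  · intro u t hconv hs hd
    have hbass := (generalizedJoin H X).det_one_sub_bartholdiEdgeMatrix (1 - u) t hs
    -- Degrees are constant on parts, so the diagonal of Bass' vertex matrix is too, and the join
    -- formula applies with `a = -t`.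
    have hvertex : (generalizedJoin H X).bartholdiVertexMatrix (1 - u) t
        = -t • (generalizedJoin H X).adjMatrix ℂ
          + Matrix.diagonal fun v : Σ i, V i => joinZetaDegree V H k u t v.1 := by
      rw [SimpleGraph.bartholdiVertexMatrix]
      congr 2
      funext v
      rw [degree_generalizedJoin H hk v.1 v.2]
      rfl
    have hdet := det_generalizedJoin H hk (-t) (joinZetaDegree V H k u t) hd
    rw [SimpleGraph.inv_bartholdiZeta _ hconv, hbass, hvertex, mul_assoc, mul_assoc, ← hdet.1,
      ← hdet.2]
    exact ⟨rfl, rfl⟩
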